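/- **Conventions.** All vector spaces are over $\mathbb C$. A cubic form is identified with its polarization, a symmetric trilinear form; thus for a cubic $C$ on $W$ we have $C(r^3)\in\mathbb C$, $C(rt)\in W^*$, and for a cubic $C^*$ on $W^*$ we have $C^*(s^*t^*)\in W$. Let $W$ be finite-dimensional, $\mathfrak h\subset\mathfrak{gl}(W)$ a Lie subalgebra, $C$ a cubic on $W$ and $C^*$ a cubic on $W^*$, both $\mathfrak h$-invariant. Put $\mathfrak g=W^*\oplus(\mathfrak h+\mathbb C)\oplus W$ and $V=\mathbb C\oplus W\oplus W^*\oplus\mathbb C$, and let $\mathfrak g$ act on $V$ by the following operators on $w=\alpha\oplus r\oplus s^*\oplus\beta^*$: $\mathfrak h$ acts naturally on each summand (trivially on the two copies of $\mathbb C$); $\mathbf 1\in\mathbb C$ acts by $-\frac32,-\frac12,\frac12,\frac32$ on the four summands; and for $t\in W$, $t^*\in W^*$ $$t.w=0\oplus 3\alpha t\oplus C(rt)\oplus\tfrac12\langle t,s^*\rangle,\qquad t^*.w=\tfrac12\langle r,t^*\rangle\oplus C^*(s^*t^*)\oplus 3\beta^*t^*\oplus 0 .$$ We say that *$\mathfrak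 g$ acts on $V$* if the resulting linear map $\mathfrak g\to\operatorname{End}V$ is injective with image closed under commutators (so that $\mathfrak g$ is a Lie algebra and $V$ a $\mathfrak g$-module). Let $$Q(w)=\bigl(3\alpha\beta^*-\tfrac12\langle r,s^*\rangle\bigr)^2+\tfrac13\bigl(\beta^*C(r^3)+\alpha C^*(s^{*3})\bigr)-\tfrac16\langle C^*(s^{*2}),C(r^2)\rangle ;$$ it is called *$\mathfrak g$-invariant* if for every $X\in\mathfrak g$ and $w\in V$ the derivative of $Q$ at $w$ in the direction $X.w$ is zero. **Proposition.** 1. Suppose that $\mathfrak h$ is semisimple, that $W$ is an irreducible $\mathfrak h$-module, that $S^2W\cong W^*\oplus S$ as $\mathfrak h$-modules with $S$ irreducible or zero, and that $C\neq0$ is an $\mathfrak h$-invariant cubic on $W$. Then there is a nonzero $\mathfrak h$-invariant cubic on $W^*$, and for every such cubic $C^*$ there is a nonzero constant $c\in\mathbb C$ such that, after replacing $C^*$ by $cC^*$, the quartic $Q$ is $\mathfrak g$-invariant. If moreover $\Lambda^2W$ is irreducible or zero, or if $\mathfrak h$ is the algebra of all endomorphisms of $W$ annihilating $C$, then with this normalization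 $\mathfrak g$ acts on $V$. Conversely $c$ is the only complex number for which $Q$ is $\mathfrak g$-invariant, and no other complex number makes $\mathfrak g$ act on $V$; in particular, whenever $\mathfrak g$ acts on $V$, $Q$ is $\mathfrak g$-invariant. 2. Let $\mathbb A$ be a finite-dimensional complex composition algebra, that is, a not necessarily associative algebra with unit and with a multiplicative quadratic form $N$ whose polar form is nondegenerate ($\mathbb A=0$ is allowed); write $\operatorname{tr}(x)\in\mathbb C$ for the polar form of $N$ at $(x,1)$ and $\bar x=\operatorname{tr}(x)1-x$. Let $W=\mathcal J_3(\mathbb A)$ be the space of Hermitian matrices $\begin{pmatrix}r_1&\bar x_3&\bar x_2\\x_3&r_2&\bar x_1\\x_2&x_1&r_3\end{pmatrix}$ with $r_i\in\mathbb C$, $x_i\in\mathbb A$, let $C$ be the determinant, $C(X^3)=r_1r_2r_3-\sum_i r_iN(x_i)+\operatorname{tr}((\bar x_3\bar x_1)x_2)$, and let $\mathfrak h=\mathfrak{sl}_3(\mathbb A)$ be the algebra of all endomorphisms of $W$ annihilating $C$. Then there is a nonzero $\mathfrak h$-invariant cubic $C^*$ on $W^*$ such that $\mathfrak g=\mathfrak{sp}_6(\mathbb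 A)$ acts on $V=\mathcal Z_2(\mathbb A)$ and $Q$ is $\mathfrak g$-invariant. 3. Let $W=\mathbb C$, $\mathfrak h=0$ and $C(x^3)=x^3$. Then there is a nonzero cubic $C^*$ on $W^*$ such that $\mathfrak g$ acts on $V$, $Q$ is $\mathfrak g$-invariant, and there are nonzero $a,b\in\mathbb C$ such that, for all $w=\alpha\oplus r\oplus s^*\oplus\beta^*$, $-3\,Q(w)$ is the discriminant $p_1^2p_2^2-4p_0p_2^3-4p_1^3p_3-27p_0^2p_3^2+18p_0p_1p_2p_3$ of the cubic $p_0x^3+p_1x^2+p_2x+p_3$ with $p_0=\alpha$, $p_1=ar$, $p_2=b\langle 1,s^*\rangle$, $p_3=\beta^*$. -/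

import Mathlib

open scoped TensorProduct

universe u v

attribute [local instance 100] LieRing.ofAssociativeRing

noncomputable section

namespace Freudenthal

/-! ### Cubic forms

A cubic form on a complex vector space is represented by its polarization, a symmetric trilinear
form; the cubic itself is `x ↦ C x x x`. -/

/-- Trilinear forms on `M`. -/
abbrev Trilinear (M : Type u) [AddCommGroup M] [Module ℂ M] : Type u :=
  M →ₗ[ℂ] M →ₗ[ℂ] M →ₗ[ℂ] ℂ

section General

variable {W : Type u} [AddCommGroup W] [Module ℂ W]

/-- The trilinear form `C` is symmetric. -/
def IsSymm (C : Trilinear W) : Prop :=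
  (∀ x y z, C x y z = C y x z) ∧ ∀ x y z, C x y z = C x z y

/-- The endomorphism `D` annihilates the trilinear form `C`. -/
def Annihilates (D : Module.End ℂ W) (C : Trilinear W) : Prop :=
  ∀ x y z, C (D x) y z + C x (D y) z + C x y (D z) = 0

/-- The cubic `C` on `W` is invariant under the linear Lie algebra `𝔥`. -/
def IsInvariant (𝔥 : LieSubalgebra ℂ (Module.End ℂ W)) (C : Trilinear W) : Prop :=
  ∀ D ∈ 𝔥, Annihilates D C

/-- The cubic `Cd` on the dual of `W` is invariant under the linear Lie algebra `𝔥`, which acts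
on the dual of `W` by the contragredient representation `D ↦ -Dᵀ`. -/
def IsDualInvariant (𝔥 : LieSubalgebra ℂ (Module.End ℂ W))
    (Cd : Trilinear (Module.Dual ℂ W)) : Prop :=
  ∀ D ∈ 𝔥, Annihilates (-(LinearMap.dualMap D)) Cd

/-- The Lie algebra of all endomorphisms of `W` that annihilate `C`. -/
def stabilizer (C : Trilinear W) : LieSubalgebra ℂ (Module.End ℂ W) where
  carrier := {D | Annihilates D C}
  zero_mem' := by intro x y z; simp
  add_mem' := by
    intro D E hD hE x y z
    have h1 := hD x y z
    have h2 := hE x y z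
    simp only [LinearMap.add_apply, map_add]
    linear_combination h1 + h2
  smul_mem' := by
    intro c D hD x y z
    have h1 := hD x y z
    simp only [LinearMap.smul_apply, map_smul, smul_eq_mul]
    linear_combination c * h1
  lie_mem' := by
    intro D E hD hE x y z
    simp only [LieRing.of_associative_ring_bracket, LinearMap.sub_apply, Module.End.mul_apply,
      map_sub]
    linear_combination hD (E x) y z + hD x (E y) z + hD x y (E z) - hE (D x) y z -
      hE x (D y) z - hE x y (D z)

/-- The second symmetric power of `W`, as the `𝔥`-submodule of symmetric tensors in `W ⊗ W`. -/
def symSquare (𝔥 : LieSubalgebra ℂ (Module.End ℂ W)) : LieSubmodule ℂ 𝔥 (W ⊗[ℂ] W) where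
  toSubmodule := LinearMap.ker ((TensorProduct.comm ℂ W W).toLinearMap - LinearMap.id)
  lie_mem := by
    intro D x hx
    have key : ∀ y : W ⊗[ℂ] W,
        TensorProduct.comm ℂ W W ⁅D, y⁆ = ⁅D, TensorProduct.comm ℂ W W y⁆ := by
      intro y
      induction y with
      | zero => simp
      | tmul a b => simp [add_comm]
      | add a b ha hb => rw [lie_add, map_add, map_add, lie_add, ha, hb]
    have hx' : TensorProduct.comm ℂ W W x = x := by
      simpa [sub_eq_zero] using hx
    change ⁅D, x⁆ ∈ LinearMap.ker ((TensorProduct.comm ℂ W W).toLinearMap - LinearMap.id)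
    rw [LinearMap.mem_ker, LinearMap.sub_apply, LinearEquiv.coe_coe, key, hx',
      LinearMap.id_apply, sub_self]

/-- The second exterior power of `W`, as the `𝔥`-submodule of antisymmetric tensors in `W ⊗ W`. -/
def altSquare (𝔥 : LieSubalgebra ℂ (Module.End ℂ W)) : LieSubmodule ℂ 𝔥 (W ⊗[ℂ] W) where
  toSubmodule := LinearMap.ker ((TensorProduct.comm ℂ W W).toLinearMap + LinearMap.id)
  lie_mem := by
    intro D x hx
    have key : ∀ y : W ⊗[ℂ] W,
        TensorProduct.comm ℂ W W ⁅D, y⁆ = ⁅D, TensorProduct.comm ℂ W W y⁆ := by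
      intro y
      induction y with
      | zero => simp
      | tmul a b => simp [add_comm]
      | add a b ha hb => rw [lie_add, map_add, map_add, lie_add, ha, hb]
    have hx' : TensorProduct.comm ℂ W W x = -x := by
      simpa [add_eq_zero_iff_eq_neg] using hx
    change ⁅D, x⁆ ∈ LinearMap.ker ((TensorProduct.comm ℂ W W).toLinearMap + LinearMap.id)
    rw [LinearMap.mem_ker, LinearMap.add_apply, LinearEquiv.coe_coe, key, hx',
      LinearMap.id_apply, lie_neg, neg_add_cancel]

/-- The Lie submodule `N` is irreducible or zero. -/
def IsIrreducibleOrZero {𝔥 : LieSubalgebra ℂ (Module.End ℂ W)} {M : Type u} [AddCommGroup M]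
    [Module ℂ M] [LieRingModule 𝔥 M] [LieModule ℂ 𝔥 M] (N : LieSubmodule ℂ 𝔥 M) : Prop :=
  N = ⊥ ∨ LieModule.IsIrreducible ℂ 𝔥 N

/-- `S²W = W* ⊕ S` as `𝔥`-modules, with `S` irreducible or zero. -/
def SymSquareSplits (𝔥 : LieSubalgebra ℂ (Module.End ℂ W)) : Prop :=
  ∃ U S : LieSubmodule ℂ 𝔥 (W ⊗[ℂ] W), U ⊔ S = symSquare 𝔥 ∧ Disjoint U S ∧
    Nonempty (U ≃ₗ⁅ℂ, 𝔥⁆ Module.Dual ℂ W) ∧ IsIrreducibleOrZero S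

/-! ### The action of `𝔤 = W* ⊕ (𝔥 + ℂ) ⊕ W` on `V = ℂ ⊕ W ⊕ W* ⊕ ℂ` -/

/-- `V = ℂ ⊕ W ⊕ W* ⊕ ℂ`; the element `α ⊕ r ⊕ s* ⊕ β*` is `(α, r, s, β)`. -/
abbrev V (W : Type u) [AddCommGroup W] [Module ℂ W] : Type u :=
  ℂ × W × Module.Dual ℂ W × ℂ

/-- The vector space `𝔤 = W* ⊕ (𝔥 + ℂ) ⊕ W`; its elements are written `(t*, (D, c), t)`. -/
abbrev G (𝔥 : LieSubalgebra ℂ (Module.End ℂ W)) : Type u :=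
  Module.Dual ℂ W × (𝔥 × ℂ) × W

variable [FiniteDimensional ℂ W]

/-- The contraction `Cd(s* t*) ∈ W` of a cubic on `W*` with two elements of `W*`. -/
def contract (Cd : Trilinear (Module.Dual ℂ W)) (s t : Module.Dual ℂ W) : W :=
  (Module.evalEquiv ℂ W).symm (Cd s t)

/-- The action of `X = (t*, (D, c), t)` on `V`, the sum of four terms:
* `D ∈ 𝔥` acts naturally on each summand, trivially on the two copies of `ℂ`;
* `1 ∈ ℂ` acts by `-3/2`, `-1/2`, `1/2`, `3/2` on the four summands;
* `t` sends `(α, r, s, β)` to `(0, 3 α t, C(r t), ⟨t, s⟩ / 2)`;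
* `t*` sends `(α, r, s, β)` to `(⟨r, t*⟩ / 2, Cd(s t*), 3 β t*, 0)`. -/
def actFun (𝔥 : LieSubalgebra ℂ (Module.End ℂ W)) (C : Trilinear W)
    (Cd : Trilinear (Module.Dual ℂ W)) (X : G 𝔥) (w : V W) : V W :=
  (0, (X.2.1.1 : Module.End ℂ W) w.2.1,
      -(LinearMap.dualMap (X.2.1.1 : Module.End ℂ W) w.2.2.1), 0) +
  X.2.1.2 • (-(3 / 2 : ℂ) * w.1, -(1 / 2 : ℂ) • w.2.1, (1 / 2 : ℂ) • w.2.2.1,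
      (3 / 2 : ℂ) * w.2.2.2) +
  (0, (3 * w.1) • X.2.2, C w.2.1 X.2.2, (1 / 2 : ℂ) * w.2.2.1 X.2.2) +
  ((1 / 2 : ℂ) * X.1 w.2.1, contract Cd w.2.2.1 X.1, (3 * w.2.2.2) • X.1, 0)

/-- The action of `𝔤` on `V` as a linear map `𝔤 → End V`. -/
def act (𝔥 : LieSubalgebra ℂ (Module.End ℂ W)) (C : Trilinear W)
    (Cd : Trilinear (Module.Dual ℂ W)) : G 𝔥 →ₗ[ℂ] Module.End ℂ (V W) :=
  LinearMap.mk₂ ℂ (actFun 𝔥 C Cd)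
    (by
      rintro ⟨a, ⟨D, c⟩, t⟩ ⟨a', ⟨D', c'⟩, t'⟩ ⟨α, r, s, β⟩
      ext <;> simp [actFun, contract] <;> first | module | ring)
    (by
      rintro k ⟨a, ⟨D, c⟩, t⟩ ⟨α, r, s, β⟩
      ext <;> simp [actFun, contract] <;> first | module | ring)
    (by
      rintro ⟨a, ⟨D, c⟩, t⟩ ⟨α, r, s, β⟩ ⟨α', r', s', β'⟩
      ext <;> simp [actFun, contract] <;> first | module | ring)
    (by
      rintro k ⟨a, ⟨D, c⟩, t⟩ ⟨α, r, s, β⟩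
      ext <;> simp [actFun, contract] <;> first | module | ring)

/-- The formulae for the action define on `𝔤` the structure of a Lie algebra, of which `V` is a
(faithful) module: `𝔤 → End V` is injective, and its image is closed under commutators. -/
def IsLieAction (𝔥 : LieSubalgebra ℂ (Module.End ℂ W)) (C : Trilinear W)
    (Cd : Trilinear (Module.Dual ℂ W)) : Prop :=
  Function.Injective (act 𝔥 C Cd) ∧
    ∀ X Y : G 𝔥, ∃ Z : G 𝔥, act 𝔥 C Cd Z = ⁅act 𝔥 C Cd X, act 𝔥 C Cd Y⁆

/-- The quartic
`Q(α, r, s, β) = (3αβ - ⟨r, s⟩/2)² + (β C(r³) + α Cd(s³))/3 - ⟨Cd(s²), C(r²)⟩/6` on `V`. -/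
def Q (C : Trilinear W) (Cd : Trilinear (Module.Dual ℂ W)) (w : V W) : ℂ :=
  (3 * w.1 * w.2.2.2 - 1 / 2 * w.2.2.1 w.2.1) ^ 2 +
    1 / 3 * (w.2.2.2 * C w.2.1 w.2.1 w.2.1 + w.1 * Cd w.2.2.1 w.2.2.1 w.2.2.1) -
    1 / 6 * C w.2.1 w.2.1 (contract Cd w.2.2.1 w.2.2.1)

/-- The quartic `Q` is `𝔤`-invariant: for every `X ∈ 𝔤`, the derivative of `Q` at any `w ∈ V` in
the direction `X.w` vanishes. -/
def QIsInvariant (𝔥 : LieSubalgebra ℂ (Module.End ℂ W)) (C : Trilinear W)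
    (Cd : Trilinear (Module.Dual ℂ W)) : Prop :=
  ∀ (X : G 𝔥) (w : V W), HasDerivAt (fun z : ℂ => Q C Cd (w + z • act 𝔥 C Cd X w)) 0 0

end General

/-! ### Composition algebras and Hermitian matrices of order three -/

section Composition

variable {A : Type v} [NonAssocRing A] [Module ℂ A]

/-- `N` makes `A` a composition algebra: it is multiplicative, with nondegenerate polar form. -/
structure IsCompositionNorm (N : QuadraticForm ℂ A) : Prop where
  map_mul : ∀ x y, N (x * y) = N x * N y
  nondegenerate : ∀ x, (∀ y, QuadraticMap.polar N x y = 0) → x = 0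

/-- The trace `x + x̄`, as a complex number. -/
def trace (N : QuadraticForm ℂ A) (x : A) : ℂ := QuadraticMap.polar N x 1

/-- The conjugate `x̄`. -/
def conj (N : QuadraticForm ℂ A) (x : A) : A := trace N x • (1 : A) - x

/-- `𝒥₃(A)`: the Hermitian matrix
`!![r₁, x̄₃, x̄₂; x₃, r₂, x̄₁; x₂, x₁, r₃]`, with `rᵢ ∈ ℂ` and `xᵢ ∈ A`, is the pair `(r, x)`
(indices are shifted to `0, 1, 2`). -/
abbrev J3 (A : Type v) : Type v := (Fin 3 → ℂ) × (Fin 3 → A)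

/-- The determinant of a Hermitian matrix of order three:
`r₁r₂r₃ - r₁N(x₁) - r₂N(x₂) - r₃N(x₃) + tr((x̄₃x̄₁)x₂)`. -/
def det (N : QuadraticForm ℂ A) (X : J3 A) : ℂ :=
  X.1 0 * X.1 1 * X.1 2 - X.1 0 * N (X.2 0) - X.1 1 * N (X.2 1) - X.1 2 * N (X.2 2) +
    trace N ((conj N (X.2 2) * conj N (X.2 0)) * X.2 1)

end Composition

end Freudenthal

end

/-!
Both conditions on `(C, Cd)` amount to the quartic identity `Cd(C(r²)²) = 2 C(r³) r` and its dual.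
Closure under commutators asks that the operators `dOp C Cd t a` lie in `𝔥`, hence annihilate `C`,
and this annihilation is the polarized quartic identity; the derivative of `Q` along `𝔤` vanishes
exactly when both identities hold.

In the irreducible case, `C` and `Cd` compose to an equivariant map `S²W → W* → S²W`. The Casimir
operator of `𝔥` acts on the two summands of `S²W` by scalars, which differ unless `S = 0`, so by
Schur's lemma the composite is `l + m · Casimir`. The Casimir element has its factors in `𝔥`, which
annihilates `C`, so pairing the composite on `r ⊗ r` with `C(r²)` kills the Casimir term and leaves
`Cd(C(r²)²) = l C(r³) r`; here `l ≠ 0`, and rescaling `Cd` makes it `2`.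

For Hermitian matrices and for the binary cubic, the quartic identity is `X^## = det(X) X`, with `W`
and `W*` identified by the trace form.
-/

noncomputable section

namespace Freudenthal

/-! ### Symmetric trilinear forms and the action of `𝔤` -/

section Symmetric

variable {M : Type u} [AddCommGroup M] [Module ℂ M] {C : Trilinear M}

theorem IsSymm.apply_comm (hC : IsSymm C) (x y : M) : C x y = C y x :=
  LinearMap.ext (hC.1 x y)

theorem IsSymm.rotate (hC : IsSymm C) (x y z : M) : C x y z = C y z x :=
  (hC.1 x y z).trans (hC.2 y x z)

theorem IsSymm.smul (hC : IsSymm C) (c : ℂ) : IsSymm (c • C) :=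
  ⟨fun x y z => congrArg (c * ·) (hC.1 x y z), fun x y z => congrArg (c * ·) (hC.2 x y z)⟩

theorem IsSymm.six_mul_apply (hC : IsSymm C) (x y z : M) :
    6 * C x y z = C (x + y + z) (x + y + z) (x + y + z) - C (x + y) (x + y) (x + y) -
      C (x + z) (x + z) (x + z) - C (y + z) (y + z) (y + z) +
      C x x x + C y y y + C z z z := by
  simp only [map_add, LinearMap.add_apply]
  linear_combination 3 * hC.2 x y z + 2 * hC.1 x y z + hC.2 y x z + 2 * hC.1 x z y +
    hC.2 z x y

theorem IsSymm.eq_zero_of_diag (hC : IsSymm C) (h : ∀ x, C x x x = 0) : C = 0 := by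
  ext x y z
  have h6 := hC.six_mul_apply x y z
  simp only [h, sub_zero, add_zero] at h6
  simpa using h6

theorem IsSymm.exists_diag_ne_zero (hC : IsSymm C) (hC0 : C ≠ 0) : ∃ x, C x x x ≠ 0 := by
  by_contra! h
  exact hC0 (hC.eq_zero_of_diag h)

theorem IsSymm.annihilates_of_diag (hC : IsSymm C) {D : Module.End ℂ M}
    (h : ∀ r, C (D r) r r = 0) : Annihilates D C := by
  let E : Trilinear M := C.comp D + C.compl₁₂ LinearMap.id D + C.compr₂ (LinearMap.lcomp ℂ ℂ D)
  have hE : ∀ x y z, E x y z = C (D x) y z + C x (D y) z + C x y (D z) := fun _ _ _ => rfl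
  have hE_symm : IsSymm E :=
    ⟨fun x y z => by rw [hE, hE, hC.1 (D x), hC.1 x (D y), hC.1 x y]; ring,
      fun x y z => by rw [hE, hE, hC.2 (D x), hC.2 x (D y), hC.2 x y]; ring⟩
  have hE_zero : E = 0 := hE_symm.eq_zero_of_diag fun x => by
    rw [hE, hC.1 x (D x), ← hC.rotate (D x) x x, h, add_zero, add_zero]
  intro x y z
  rw [← hE, hE_zero]
  rfl

theorem Annihilates.apply_diag_add {D : Module.End ℂ M} (hD : Annihilates D C) (hC : IsSymm C)
    (r u : M) : 2 * C (D r) r u + C r r (D u) = 0 := by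
  linear_combination hD r r u + hC.1 (D r) r u

theorem Annihilates.apply_diag {D : Module.End ℂ M} (hD : Annihilates D C) (hC : IsSymm C)
    (r : M) : C (D r) r r = 0 := by
  linear_combination (1 / 3 : ℂ) * (hD.apply_diag_add hC r r + hC.rotate (D r) r r)

theorem polarize_quartic {N : Type*} [AddCommGroup N] [Module ℂ N] (hC : IsSymm C)
    {q : M →ₗ[ℂ] M →ₗ[ℂ] N} (hq : ∀ x y, q x y = q y x)
    {p : N →ₗ[ℂ] N →ₗ[ℂ] ℂ} (hp : ∀ x y, p x y = p y x) {s : Module.Dual ℂ M} {l : ℂ}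
    (h : ∀ r, p (q r r) (q r r) = l * C r r r * s r) (r t : M) :
    4 * p (q r t) (q r r) = l * (3 * C r r t * s r + C r r r * s t) := by
  -- The coefficient of `z` in the quartic polynomial `z ↦ p (q (r + z t)²) (q (r + z t)²)`.
  have h₁ := h (r + t)
  have h₂ := h (r + (-1 : ℂ) • t)
  have h₃ := h (r + (2 : ℂ) • t)
  have h₄ := h (r + (-2 : ℂ) • t)
  simp only [map_add, LinearMap.add_apply, map_smul, LinearMap.smul_apply, smul_eq_mul, hq t r,
    hp (q r r), hp (q t t) (q r t), hC.rotate t r r, hC.2 r t r, hC.rotate t t r,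
    hC.rotate t r t] at h₁ h₂ h₃ h₄
  linear_combination (1 / 12 : ℂ) * (8 * (h₁ - h₂) - (h₃ - h₄))

/-- The symmetrization of a trilinear form, the average over the six permutations of its
arguments. -/
def symmetrize (T : Trilinear M) : Trilinear M :=
  let U := T + LinearMap.lflip.toLinearMap ∘ₗ T
  (1 / 6 : ℂ) • (U + U.flip + LinearMap.lflip.toLinearMap ∘ₗ U.flip)

theorem symmetrize_apply (T : Trilinear M) (x y z : M) :
    symmetrize T x y z =
      1 / 6 * (T x y z + T x z y + T y x z + T y z x + T z x y + T z y x) := by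
  change 1 / 6 * (T x y z + T x z y + (T y x z + T y z x) + (T z x y + T z y x)) = _
  ring

theorem isSymm_symmetrize (T : Trilinear M) : IsSymm (symmetrize T) :=
  ⟨fun x y z => by simp only [symmetrize_apply]; ring,
    fun x y z => by simp only [symmetrize_apply]; ring⟩

theorem Annihilates.symmetrize {T : Trilinear M} {D : Module.End ℂ M} (hD : Annihilates D T) :
    Annihilates D (symmetrize T) := fun x y z => by
  simp only [symmetrize_apply]
  linear_combination
    (1 / 6 : ℂ) * (hD x y z + hD x z y + hD y x z + hD y z x + hD z x y + hD z y x)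

end Symmetric

section Contraction

variable {W : Type u} [AddCommGroup W] [Module ℂ W]
  {C : Trilinear W} {Cd : Trilinear (Module.Dual ℂ W)} {l : ℂ}

/-- The quartic identity `Cd(C(r²)²) = l C(r³) r`. -/
def SharpIdentity (C : Trilinear W) (Cd : Trilinear (Module.Dual ℂ W)) (l : ℂ) : Prop :=
  ∀ (r : W) (s : Module.Dual ℂ W), Cd (C r r) (C r r) s = l * C r r r * s r

theorem SharpIdentity.polar (h : SharpIdentity C Cd l) (hC : IsSymm C) (hCd : IsSymm Cd)
    (r t : W) (s : Module.Dual ℂ W) :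
    4 * Cd (C r t) (C r r) s = l * (3 * C r r t * s r + C r r r * s t) :=
  polarize_quartic hC hC.apply_comm (p := Cd.compr₂ (LinearMap.applyₗ s))
    (fun x y => hCd.1 x y s) (fun r => h r s) r t

variable [FiniteDimensional ℂ W]

/-- The contraction `contract Cd` as a bilinear map. -/
def contractHom (Cd : Trilinear (Module.Dual ℂ W)) :
    Module.Dual ℂ W →ₗ[ℂ] Module.Dual ℂ W →ₗ[ℂ] W :=
  Cd.compr₂ (Module.evalEquiv ℂ W).symm.toLinearMap

@[simp] theorem contractHom_apply (Cd : Trilinear (Module.Dual ℂ W)) (s t : Module.Dual ℂ W) :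
    contractHom Cd s t = contract Cd s t := rfl

@[simp] theorem apply_contract (Cd : Trilinear (Module.Dual ℂ W)) (s t u : Module.Dual ℂ W) :
    u (contract Cd s t) = Cd s t u :=
  Module.apply_evalEquiv_symm_apply (R := ℂ) (M := W) u (Cd s t)

theorem contract_comm (hCd : IsSymm Cd) (s t : Module.Dual ℂ W) :
    contract Cd s t = contract Cd t s := by
  rw [contract, hCd.apply_comm, contract]

/-- The commutator of `t ∈ W` and `a ∈ W*` acts on `W` as `dOp C Cd t a - ⟨t, a⟩ / 2`. -/
def dOp (C : Trilinear W) (Cd : Trilinear (Module.Dual ℂ W)) (t : W)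
    (a : Module.Dual ℂ W) : Module.End ℂ W :=
  (3 / 2 : ℂ) • a.smulRight t + ((1 / 2 : ℂ) * a t) • LinearMap.id -
    ((contractHom Cd).flip a).comp (C.flip t)

theorem dOp_apply (C : Trilinear W) (Cd : Trilinear (Module.Dual ℂ W)) (t : W)
    (a : Module.Dual ℂ W) (r : W) :
    dOp C Cd t a r = (3 / 2 * a r : ℂ) • t + (1 / 2 * a t : ℂ) • r - contract Cd (C r t) a := by
  simp only [dOp, LinearMap.sub_apply, LinearMap.add_apply, LinearMap.smul_apply,
    LinearMap.smulRight_apply, smul_smul, LinearMap.id_apply, LinearMap.comp_apply,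
    LinearMap.flip_apply, contractHom_apply]

/-- The quartic identity `C(Cd(s²)²) = l Cd(s³) s`. -/
def DualSharpIdentity (C : Trilinear W) (Cd : Trilinear (Module.Dual ℂ W)) (l : ℂ) : Prop :=
  ∀ (r : W) (s : Module.Dual ℂ W),
    C (contract Cd s s) (contract Cd s s) r = l * Cd s s s * s r

theorem DualSharpIdentity.polar (h : DualSharpIdentity C Cd l) (hC : IsSymm C)
    (hCd : IsSymm Cd) (r : W) (s t : Module.Dual ℂ W) :
    4 * C (contract Cd s t) (contract Cd s s) r = l * (3 * Cd s s t * s r + Cd s s s * t r) :=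
  polarize_quartic hCd (q := contractHom Cd) (contract_comm hCd)
    (p := C.compr₂ (LinearMap.applyₗ r)) (fun x y => hC.1 x y r)
    (s := Module.Dual.eval ℂ W r) (fun s => h r s) s t

theorem apply_dOp_diag (hC : IsSymm C) (hCd : IsSymm Cd) (t : W) (a : Module.Dual ℂ W) (r : W) :
    C (dOp C Cd t a r) r r =
      3 / 2 * a r * C r r t + 1 / 2 * a t * C r r r - Cd (C r t) (C r r) a := by
  simp only [dOp_apply, map_add, map_sub, map_smul, LinearMap.add_apply, LinearMap.sub_apply,
    LinearMap.smul_apply, smul_eq_mul, hC.rotate t r r, hC.rotate (contract Cd (C r t) a) r r,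
    apply_contract, hCd.2 (C r t) a]

theorem SharpIdentity.annihilates_dOp (h : SharpIdentity C Cd 2) (hC : IsSymm C)
    (hCd : IsSymm Cd) (t : W) (a : Module.Dual ℂ W) : Annihilates (dOp C Cd t a) C :=
  hC.annihilates_of_diag fun r => by
    rw [apply_dOp_diag hC hCd]
    linear_combination -(1 / 4 : ℂ) * h.polar hC hCd r t a

theorem sharpIdentity_of_annihilates_dOp (hC : IsSymm C) (hCd : IsSymm Cd)
    (h : ∀ t a, Annihilates (dOp C Cd t a) C) : SharpIdentity C Cd 2 := fun r s => by
  have hr := (h r s).apply_diag hC r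
  rw [apply_dOp_diag hC hCd] at hr
  linear_combination -hr

end Contraction

section Action

variable {W : Type u} [AddCommGroup W] [Module ℂ W] [FiniteDimensional ℂ W]
  {C : Trilinear W} {Cd : Trilinear (Module.Dual ℂ W)} {𝔥 : LieSubalgebra ℂ (Module.End ℂ W)}

theorem act_apply (X : G 𝔥) (w : V W) : act 𝔥 C Cd X w = actFun 𝔥 C Cd X w := rfl

theorem act_injective : Function.Injective (act 𝔥 C Cd) := by
  refine (injective_iff_map_eq_zero _).2 ?_
  rintro ⟨a, ⟨D, c⟩, t⟩ h
  have on_fst : act 𝔥 C Cd (a, (D, c), t) (1, 0, 0, 0) = 0 := by rw [h]; rfl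
  have on_last : act 𝔥 C Cd (a, (D, c), t) (0, 0, 0, 1) = 0 := by rw [h]; rfl
  have on_W : ∀ r, act 𝔥 C Cd (a, (D, c), t) (0, r, 0, 0) = 0 := fun r => by rw [h]; rfl
  simp only [act_apply, actFun, contract, map_zero, LinearMap.zero_apply, smul_zero, mul_zero,
    neg_zero, zero_add, add_zero, mul_one, Prod.smul_mk, Prod.mk_add_mk, smul_eq_mul,
    Prod.mk_eq_zero] at on_fst on_last on_W
  obtain rfl : c = 0 := by linear_combination -(2 / 3 : ℂ) * on_fst.1
  obtain rfl : t = 0 := by simpa using on_fst.2.1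
  obtain rfl : a = 0 := by simpa using on_last.2.2.1
  have hD : D = 0 := Subtype.ext (LinearMap.ext fun r => by simpa using (on_W r).2.1)
  rw [hD]
  rfl

/-- The bracket of `𝔤` that makes `act` a homomorphism, available once the operators
`dOp C Cd t a` lie in `𝔥`. -/
def bracket (H : ∀ t a, dOp C Cd t a ∈ 𝔥) (X Y : G 𝔥) : G 𝔥 :=
  (-(LinearMap.dualMap (X.2.1.1 : Module.End ℂ W) Y.1) - X.2.1.2 • Y.1 +
      LinearMap.dualMap (Y.2.1.1 : Module.End ℂ W) X.1 + Y.2.1.2 • X.1,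
    (⁅X.2.1.1, Y.2.1.1⁆ + ⟨dOp C Cd X.2.2 Y.1, H _ _⟩ - ⟨dOp C Cd Y.2.2 X.1, H _ _⟩,
      Y.1 X.2.2 - X.1 Y.2.2),
    (X.2.1.1 : Module.End ℂ W) Y.2.2 + X.2.1.2 • Y.2.2 -
      (Y.2.1.1 : Module.End ℂ W) X.2.2 - Y.2.1.2 • X.2.2)

theorem act_bracket (H : ∀ t a, dOp C Cd t a ∈ 𝔥) (hC : IsSymm C) (hCd : IsSymm Cd)
    (hi : IsInvariant 𝔥 C) (hdi : IsDualInvariant 𝔥 Cd) (X Y : G 𝔥) :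
    act 𝔥 C Cd (bracket H X Y) = ⁅act 𝔥 C Cd X, act 𝔥 C Cd Y⁆ := by
  obtain ⟨a, ⟨⟨D, hD⟩, c⟩, t⟩ := X
  obtain ⟨a', ⟨⟨D', hD'⟩, c'⟩, t'⟩ := Y
  refine LinearMap.ext fun ⟨α, r, s, β⟩ => ?_
  simp only [LieRing.of_associative_ring_bracket, LinearMap.sub_apply, Module.End.mul_apply,
    act_apply, bracket, actFun, AddSubgroupClass.coe_sub, AddMemClass.coe_add,
    LieSubalgebra.coe_bracket, LinearMap.add_apply, LinearMap.neg_apply, LinearMap.smul_apply,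
    LinearMap.dualMap_apply, dOp_apply, map_sub, map_add, map_neg, map_smul, smul_eq_mul,
    apply_contract, Prod.smul_mk, Prod.mk_add_mk, Prod.mk_sub_mk, Prod.mk.injEq]
  refine ⟨?_, ?_, ?_, ?_⟩
  · linear_combination (1 / 2 : ℂ) * hCd.2 s a a'
  · rw [← sub_eq_zero, ← Module.forall_dual_apply_eq_zero_iff ℂ]
    intro u
    have apply_D (x : Module.Dual ℂ W) :
        u (D (contract Cd s x)) = Cd s x (LinearMap.dualMap D u) :=
      apply_contract Cd s x (LinearMap.dualMap D u)
    have apply_D' (x : Module.Dual ℂ W) :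
        u (D' (contract Cd s x)) = Cd s x (LinearMap.dualMap D' u) :=
      apply_contract Cd s x (LinearMap.dualMap D' u)
    have inv_D := hdi D hD s a' u
    have inv_D' := hdi D' hD' s a u
    simp only [LinearMap.neg_apply, map_neg] at inv_D inv_D'
    simp only [map_sub, map_add, map_neg, map_smul, LinearMap.neg_apply, LinearMap.add_apply,
      LinearMap.sub_apply, LinearMap.smul_apply, smul_eq_mul, apply_contract, apply_D, apply_D']
    linear_combination inv_D - inv_D' + 3 * β * hCd.1 a a' u
  · ext u
    have apply_contract_left (x : Module.Dual ℂ W) (y : W) :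
        C (contract Cd s x) y u = Cd (C u y) x s := by
      rw [hC.rotate, hC.1, apply_contract, hCd.rotate, hCd.rotate, hCd.2]
    simp only [LinearMap.neg_apply, LinearMap.add_apply, LinearMap.sub_apply,
      LinearMap.smul_apply, smul_eq_mul, apply_contract, apply_contract_left,
      LinearMap.dualMap_apply, map_sub, map_add, map_smul, dOp_apply]
    linear_combination hi D hD r t' u - hi D' hD' r t u + 3 * α * hC.1 t t' u
  · linear_combination (1 / 2 : ℂ) * hC.2 r t t'

theorem isLieAction_of_dOp_mem (H : ∀ t a, dOp C Cd t a ∈ 𝔥) (hC : IsSymm C) (hCd : IsSymm Cd)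
    (hi : IsInvariant 𝔥 C) (hdi : IsDualInvariant 𝔥 Cd) : IsLieAction 𝔥 C Cd :=
  ⟨act_injective, fun X Y => ⟨bracket H X Y, act_bracket H hC hCd hi hdi X Y⟩⟩

theorem IsLieAction.dOp_mem (h : IsLieAction 𝔥 C Cd) (t : W) (a : Module.Dual ℂ W) :
    dOp C Cd t a ∈ 𝔥 := by
  obtain ⟨⟨b, ⟨D, c⟩, y⟩, hZ⟩ := h.2 (0, 0, t) (a, 0, 0)
  have on_fst := LinearMap.congr_fun hZ (1, 0, 0, 0)
  have on_W := fun r => congrArg (fun w => w.2.1) (LinearMap.congr_fun hZ (0, r, 0, 0))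
  simp only [LieRing.of_associative_ring_bracket, LinearMap.sub_apply, Module.End.mul_apply,
    act_apply, actFun, contract, map_zero, map_smul, LinearMap.zero_apply, Prod.fst_zero,
    Prod.snd_zero, ZeroMemClass.coe_zero, zero_smul, smul_zero, mul_zero, neg_zero, zero_add,
    add_zero, sub_zero, mul_one, Prod.smul_mk, Prod.mk_add_mk, Prod.mk_sub_mk, smul_eq_mul,
    Prod.mk.injEq] at on_fst on_W
  obtain rfl : c = a t := by linear_combination -(2 / 3 : ℂ) * on_fst.1
  have hD : dOp C Cd t a = D.1 := by
    ext r
    rw [dOp_apply, contract]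
    linear_combination (norm := module) -on_W r
  exact hD ▸ D.2

theorem IsLieAction.sharpIdentity (h : IsLieAction 𝔥 C Cd) (hC : IsSymm C) (hCd : IsSymm Cd)
    (hi : IsInvariant 𝔥 C) : SharpIdentity C Cd 2 :=
  sharpIdentity_of_annihilates_dOp hC hCd fun t a => hi _ (h.dOp_mem t a)

end Action

/-! ### Invariance of the quartic -/

section Quartic

variable {W : Type u} [AddCommGroup W] [Module ℂ W]
  {C : Trilinear W} {Cd : Trilinear (Module.Dual ℂ W)}

theorem hasDerivAt_zero_of_eq_add_mul {f g : ℂ → ℂ} {a b : ℂ} (hg : ContinuousAt g 0)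
    (h : ∀ z, f z = a + z * b + z ^ 2 * g z) : HasDerivAt f b 0 := by
  refine hasDerivAt_iff_tendsto_slope_zero.2 ?_
  have tendsto : Filter.Tendsto (fun z => b + z * g z) (nhdsWithin 0 {0}ᶜ) (nhds b) := by
    have : ContinuousAt (fun z => b + z * g z) 0 := by fun_prop
    simpa using this.tendsto.mono_left nhdsWithin_le_nhds
  refine tendsto.congr' (eventually_nhdsWithin_of_forall fun z hz => ?_)
  have hz : z ≠ 0 := hz
  simp only [h, zero_add, smul_eq_mul]
  field_simp
  ring

theorem hasDerivAt_dual_apply (s s' : Module.Dual ℂ W) (r r' : W) :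
    HasDerivAt (fun z : ℂ => (s + z • s') (r + z • r')) (s' r + s r') 0 :=
  hasDerivAt_zero_of_eq_add_mul (a := s r) (g := fun _ => s' r') continuousAt_const fun z => by
    simp only [LinearMap.add_apply, LinearMap.smul_apply, map_add, map_smul, smul_eq_mul]
    ring

theorem IsSymm.hasDerivAt_diag (hC : IsSymm C) (r r' : W) :
    HasDerivAt (fun z : ℂ => C (r + z • r') (r + z • r') (r + z • r')) (3 * C r r r') 0 :=
  hasDerivAt_zero_of_eq_add_mul (a := C r r r)
    (g := fun z => 3 * C r r' r' + z * C r' r' r') (by fun_prop) fun z => by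
    simp only [map_add, map_smul, LinearMap.add_apply, LinearMap.smul_apply, smul_eq_mul,
      hC.rotate r' r r, hC.2 r r' r, hC.rotate r' r r', ← hC.rotate r r' r']
    ring

variable [FiniteDimensional ℂ W]

theorem hasDerivAt_apply_contract (hC : IsSymm C) (hCd : IsSymm Cd) (r r' : W)
    (s s' : Module.Dual ℂ W) :
    HasDerivAt (fun z : ℂ => C (r + z • r') (r + z • r') (contract Cd (s + z • s') (s + z • s')))
      (2 * (C r r' (contract Cd s s) + C r r (contract Cd s s'))) 0 :=
  hasDerivAt_zero_of_eq_add_mul (a := C r r (contract Cd s s))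
    (g := fun z => C r r (contract Cd s' s') + 4 * C r r' (contract Cd s s') +
      C r' r' (contract Cd s s) + 2 * z * (C r r' (contract Cd s' s') +
      C r' r' (contract Cd s s')) + z ^ 2 * C r' r' (contract Cd s' s')) (by fun_prop) fun z => by
    simp only [← contractHom_apply, map_add, map_smul, LinearMap.add_apply, LinearMap.smul_apply,
      smul_eq_mul]
    simp only [contractHom_apply, hC.apply_comm r' r, contract_comm hCd s' s]
    ring

/-- The derivative of the quartic `Q` at `w` in the direction `v`. -/
def dQ (C : Trilinear W) (Cd : Trilinear (Module.Dual ℂ W)) (w v : V W) : ℂ :=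
  2 * (3 * w.1 * w.2.2.2 - 1 / 2 * w.2.2.1 w.2.1) *
      (3 * (v.1 * w.2.2.2 + w.1 * v.2.2.2) - 1 / 2 * (v.2.2.1 w.2.1 + w.2.2.1 v.2.1)) +
    1 / 3 * (v.2.2.2 * C w.2.1 w.2.1 w.2.1 + 3 * w.2.2.2 * C w.2.1 w.2.1 v.2.1 +
      v.1 * Cd w.2.2.1 w.2.2.1 w.2.2.1 + 3 * w.1 * Cd w.2.2.1 w.2.2.1 v.2.2.1) -
    1 / 3 * (C w.2.1 v.2.1 (contract Cd w.2.2.1 w.2.2.1) +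
      C w.2.1 w.2.1 (contract Cd w.2.2.1 v.2.2.1))

theorem hasDerivAt_Q (hC : IsSymm C) (hCd : IsSymm Cd) (w v : V W) :
    HasDerivAt (fun z : ℂ => Q C Cd (w + z • v)) (dQ C Cd w v) 0 := by
  obtain ⟨α, r, s, β⟩ := w
  obtain ⟨α', r', s', β'⟩ := v
  have deriv_line (c c' : ℂ) : HasDerivAt (fun z : ℂ => c + z * c') c' 0 :=
    hasDerivAt_zero_of_eq_add_mul (a := c) (g := fun _ => 0) continuousAt_const (by simp)
  have deriv_Q := ((((((deriv_line α α').const_mul 3).mul (deriv_line β β')).sub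
      ((hasDerivAt_dual_apply s s' r r').const_mul (1 / 2))).pow 2).add
    ((((deriv_line β β').mul (hC.hasDerivAt_diag r r')).add
      ((deriv_line α α').mul (hCd.hasDerivAt_diag s s'))).const_mul (1 / 3))).sub
    ((hasDerivAt_apply_contract hC hCd r r' s s').const_mul (1 / 6))
  refine deriv_Q.congr_deriv ?_
  simp only [dQ, LinearMap.add_apply, LinearMap.smul_apply, map_add, map_smul, Pi.sub_apply,
    Pi.mul_apply, smul_eq_mul, zero_mul, zero_smul, add_zero, Nat.cast_ofNat, Nat.add_one_sub_one,
    pow_one, apply_contract]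
  ring

variable {𝔥 : LieSubalgebra ℂ (Module.End ℂ W)}

theorem qIsInvariant_iff_dQ (hC : IsSymm C) (hCd : IsSymm Cd) :
    QIsInvariant 𝔥 C Cd ↔ ∀ X w, dQ C Cd w (act 𝔥 C Cd X w) = 0 :=
  forall₂_congr fun _ _ => ⟨fun h => (hasDerivAt_Q hC hCd _ _).unique h,
    fun h => (hasDerivAt_Q hC hCd _ _).congr_deriv h⟩

theorem QIsInvariant.sharpIdentity (h : QIsInvariant 𝔥 C Cd) (hC : IsSymm C) (hCd : IsSymm Cd) :
    SharpIdentity C Cd 2 := by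
  intro r s
  have hr := (qIsInvariant_iff_dQ hC hCd).1 h (0, 0, r) (0, r, s, 0)
  have dualMap_zero : LinearMap.dualMap (0 : Module.End ℂ W) = 0 := by ext; simp
  have contract_zero : contract Cd s 0 = 0 := by simp [contract]
  simp only [dQ, act_apply, actFun, Prod.fst_zero, Prod.snd_zero, ZeroMemClass.coe_zero,
    LinearMap.zero_apply, dualMap_zero, contract_zero, map_zero, neg_zero, smul_zero, zero_smul,
    mul_zero, zero_mul, zero_add, add_zero, Prod.mk_add_mk, hCd.rotate s,
    apply_contract] at hr
  linear_combination -3 * hr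

theorem qIsInvariant_of_sharpIdentity (hC : IsSymm C) (hCd : IsSymm Cd) (hi : IsInvariant 𝔥 C)
    (hdi : IsDualInvariant 𝔥 Cd) (h : SharpIdentity C Cd 2) (hd : DualSharpIdentity C Cd 2) :
    QIsInvariant 𝔥 C Cd := by
  rw [qIsInvariant_iff_dQ hC hCd]
  rintro ⟨a, ⟨⟨D, hD⟩, c⟩, t⟩ ⟨α, r, s, β⟩
  have inv_C := (hi D hD).apply_diag hC r
  have inv_Cd := (hdi D hD).apply_diag hCd s
  have inv_C_contract := (hi D hD).apply_diag_add hC r (contract Cd s s)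
  have inv_Cd_sq := (hdi D hD).apply_diag_add hCd s (C r r)
  have adjoint : Cd s s (LinearMap.dualMap D (C r r)) = C r r (D (contract Cd s s)) :=
    (apply_contract ..).symm
  have pairing : Cd s s (C r (contract Cd s a)) = C (contract Cd s a) (contract Cd s s) r := by
    rw [← apply_contract, hC.rotate (contract Cd s a), hC.rotate, hC.rotate, hC.2]
  rw [apply_contract] at inv_C_contract
  simp only [LinearMap.neg_apply, map_neg, adjoint] at inv_Cd inv_Cd_sq
  simp only [dQ, act_apply, actFun, Prod.mk_add_mk, Prod.smul_mk, smul_eq_mul,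
    LinearMap.add_apply, LinearMap.neg_apply, LinearMap.smul_apply, LinearMap.dualMap_apply,
    map_add, map_neg, map_smul, apply_contract, pairing, hC.2 r t r, hCd.2 s a s, hC.1 r (D r),
    hCd.1 s (LinearMap.dualMap D s), ← hC.rotate (D r) r r, hCd.rotate s (C r t),
    ← hCd.rotate (LinearMap.dualMap D s) s]
  linear_combination -(1 / 12 : ℂ) * (h.polar hC hCd r t s + hd.polar hC hCd r s a) +
    β * inv_C + α * inv_Cd - (1 / 6 : ℂ) * (inv_C_contract + inv_Cd_sq)

end Quartic

/-! ### Maps between irreducible modules and the trace form -/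

section Schur

variable {k L M N : Type*} [Field k] [LieRing L]
  [AddCommGroup M] [Module k M] [LieRingModule L M]
  [AddCommGroup N] [Module k N] [LieRingModule L N]

theorem injective_of_isIrreducible [LieModule.IsIrreducible k L M] {f : M →ₗ⁅k,L⁆ N}
    (hf : f ≠ 0) : Function.Injective f := by
  rw [← LieModuleHom.ker_eq_bot]
  refine (eq_bot_or_eq_top f.ker).resolve_right fun h => hf (LieModuleHom.ext fun x => ?_)
  exact LieModuleHom.mem_ker.1 (h ▸ LieSubmodule.mem_top x)

theorem surjective_of_isIrreducible [LieModule.IsIrreducible k L N] {f : M →ₗ⁅k,L⁆ N}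
    (hf : f ≠ 0) : Function.Surjective f := by
  rw [← LieModuleHom.range_eq_top]
  refine (eq_bot_or_eq_top f.range).resolve_left fun h => hf (LieModuleHom.ext fun x => ?_)
  have mem_range : f x ∈ f.range := ⟨x, rfl⟩
  rwa [h, LieSubmodule.mem_bot] at mem_range

theorem lieModuleHom_eq_zero_of_isEmpty_equiv [LieModule.IsIrreducible k L M]
    [LieModule.IsIrreducible k L N] (h : IsEmpty (M ≃ₗ⁅k,L⁆ N)) (f : M →ₗ⁅k,L⁆ N) : f = 0 := by
  by_contra hf
  exact h.elim { f, LinearEquiv.ofBijective (f : M →ₗ[k] N)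
    ⟨injective_of_isIrreducible hf, surjective_of_isIrreducible hf⟩ with }

variable [LieAlgebra k L] [LieModule k L M]

theorem exists_eq_smul_of_isIrreducible [IsAlgClosed k] [FiniteDimensional k M]
    [LieModule.IsIrreducible k L M] (f : M →ₗ⁅k,L⁆ M) : ∃ a : k, ∀ x, f x = a • x := by
  have := LieModule.nontrivial_of_isIrreducible k L M
  obtain ⟨a, ha⟩ := Module.End.exists_eigenvalue (f : M →ₗ[k] M)
  obtain ⟨v, hv⟩ := ha.exists_hasEigenvector
  have hv_eq : f v = a • v := hv.apply_eq_smul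
  have f_eq : f - a • LieModuleHom.id = 0 := by
    by_contra h
    refine hv.2 (injective_of_isIrreducible h ?_)
    simp [hv_eq]
  exact ⟨a, fun x => sub_eq_zero.1 (LieModuleHom.congr_fun f_eq x)⟩

theorem isIrreducible_dual [FiniteDimensional k M] [LieModule.IsIrreducible k L M] :
    LieModule.IsIrreducible k L (Module.Dual k M) := by
  have := LieModule.nontrivial_of_isIrreducible k L M
  refine LieModule.IsIrreducible.mk fun N hN => ?_
  let K : LieSubmodule k L M :=
    { N.toSubmodule.dualCoannihilator with
      lie_mem := fun {x m} hm => (Submodule.mem_dualCoannihilator _).2 fun φ hφ => by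
        simpa using (Submodule.mem_dualCoannihilator _).1 hm ⁅x, φ⁆ (N.lie_mem hφ) }
  have annihilator_K : K.toSubmodule.dualAnnihilator = N.toSubmodule :=
    Subspace.dualCoannihilator_dualAnnihilator_eq (W := N.toSubmodule)
  rcases eq_bot_or_eq_top K with h | h <;> rw [h] at annihilator_K
  · simpa using annihilator_K.symm
  · exact absurd (by simpa using annihilator_K.symm) hN

end Schur

section Faithful

variable {k L M : Type*} [Field k] [LieRing L] [LieAlgebra k L] [AddCommGroup M] [Module k M]
  [LieRingModule L M] [LieModule k L M] [FiniteDimensional k M] [LieModule.IsIrreducible k L M]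
  [LieModule.IsFaithful k L M]

theorem eq_bot_of_forall_isNilpotent_toEnd {I : LieIdeal k L}
    (hI : ∀ x ∈ I, IsNilpotent (LieModule.toEnd k L M x)) : I = ⊥ := by
  have nilpotent : LieModule.IsNilpotent I M :=
    (LieModule.isNilpotent_iff_forall' (R := k)).2 fun x => hI x.1 x.2
  have lie_eq_bot : ⁅I, (⊤ : LieSubmodule k L M)⁆ = ⊥ := by
    refine (eq_bot_or_eq_top _).resolve_right fun h => ?_
    obtain ⟨n, hn⟩ := (LieModule.isNilpotent_iff k I M).1 nilpotent
    have lcs_eq_top (n : ℕ) : I.lcs M n = ⊤ := by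
      induction n with
      | zero => rfl
      | succ n ih => rw [LieIdeal.lcs_succ, ih, h]
    have top_eq_bot : (⊤ : Submodule k M) = ⊥ := by
      simpa [lcs_eq_top, hn] using I.coe_lcs_eq M n
    have := LieModule.nontrivial_of_isIrreducible k L M
    exact top_ne_bot top_eq_bot
  refine (LieSubmodule.eq_bot_iff I).2 fun x hx => ?_
  rw [← LieModule.toEnd_eq_zero_iff (R := k) (L := L) (M := M)]
  ext m
  exact (LieSubmodule.mem_bot _).1
    (lie_eq_bot ▸ LieSubmodule.lie_mem_lie hx (LieSubmodule.mem_top m))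

theorem eq_zero_of_traceForm_eq_zero [CharZero k] [LieAlgebra.HasTrivialRadical k L] {x : L}
    (hx : LieModule.traceForm k L M x = 0) : x = 0 := by
  let J : LieIdeal k L := LieAlgebra.InvariantForm.orthogonal (LieModule.traceForm k L M)
    (LieModule.traceForm_lieInvariant k L M) ⊤
  have mem_J {y : L} : y ∈ J ↔ ∀ z, LieModule.traceForm k L M z y = 0 := by
    simp [J, LieAlgebra.InvariantForm.mem_orthogonal]
  have traceForm_J : LieModule.traceForm k J M = 0 := by
    ext y z
    exact mem_J.1 z.2 y
  have nilpotent := LieModule.isNilpotent_derivedSeries_of_traceForm_eq_zero traceForm_J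
  rw [LieModule.isNilpotent_iff_forall' (R := k)] at nilpotent
  have derived_J : ⁅J, J⁆ = ⊥ := eq_bot_of_forall_isNilpotent_toEnd (M := M) fun y hy => by
    refine nilpotent ⟨⟨y, LieSubmodule.lie_le_left J J hy⟩, ?_⟩
    rwa [LieIdeal.derivedSeries_eq_derivedSeriesOfIdeal_comap, LieIdeal.mem_comap]
  have abelian_J : IsLieAbelian J := (LieAlgebra.abelian_iff_derived_one_eq_bot J).2 derived_J
  have J_eq_bot := (LieAlgebra.hasTrivialRadical_iff_no_abelian_ideals k L).1 ‹_› J abelian_J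
  refine (LieSubmodule.mem_bot x).1 (J_eq_bot ▸ mem_J.2 fun z => ?_)
  rw [LieModule.traceForm_comm, hx, LinearMap.zero_apply]

end Faithful

section Eigenvalues

variable {k M : Type*} [AddCommGroup M]

theorem hasEigenvalue_of_dualMap_eq_smul [Field k] [Module k M] [FiniteDimensional k M]
    {D : Module.End k M} {a : k} {y : Module.Dual k M} (hy : y ≠ 0)
    (h : LinearMap.dualMap D y = a • y) : D.HasEigenvalue a := by
  rw [Module.End.hasEigenvalue_iff, Module.End.eigenspace_def]
  refine fun hker => hy (LinearMap.ext fun x => ?_)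
  obtain ⟨z, rfl⟩ := LinearMap.surjective_of_injective (LinearMap.ker_eq_bot.1 hker) x
  simpa [sub_eq_zero] using LinearMap.congr_fun h z

theorem isNilpotent_of_forall_hasEigenvalue_mul [NormedField k] [IsAlgClosed k] [Module k M]
    [FiniteDimensional k M] {D : Module.End k M} {c : k} (hc : 1 < ‖c‖)
    (h : ∀ a, D.HasEigenvalue a → D.HasEigenvalue (c * a)) : IsNilpotent D := by
  have eigenvalue_eq_zero (a : k) (ha : D.HasEigenvalue a) : a = 0 := by
    obtain ⟨b, hb, hmax⟩ := (Module.End.finite_hasEigenvalue D).exists_maximalFor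
      (fun b => ‖b‖) _ ⟨a, ha⟩
    have le_of_hasEigenvalue (b' : k) (hb' : D.HasEigenvalue b') : ‖b'‖ ≤ ‖b‖ :=
      (le_total ‖b‖ ‖b'‖).elim (hmax hb') id
    have hcb := le_of_hasEigenvalue _ (h b hb)
    rw [norm_mul] at hcb
    have hab := le_of_hasEigenvalue a ha
    exact norm_le_zero_iff.1 (by nlinarith [norm_nonneg b])
  have roots_eq : (minpoly k D).roots = Multiset.replicate (minpoly k D).roots.card 0 :=
    Multiset.eq_replicate_card.2 fun b hb => eigenvalue_eq_zero b
      (Module.End.hasEigenvalue_iff_isRoot.2 (Polynomial.isRoot_of_mem_roots hb))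
  have minpoly_eq := (IsAlgClosed.splits (minpoly k D)).eq_prod_roots_of_monic
    (minpoly.monic (Algebra.IsIntegral.isIntegral D))
  rw [roots_eq] at minpoly_eq
  have aeval_minpoly := minpoly.aeval k D
  rw [minpoly_eq] at aeval_minpoly
  exact ⟨_, by simpa using aeval_minpoly⟩

end Eigenvalues

/-! ### The splitting of `S²W` -/

section SymSquare

variable {W : Type u} [AddCommGroup W] [Module ℂ W]
  {𝔥 : LieSubalgebra ℂ (Module.End ℂ W)}

theorem mem_symSquare {x : W ⊗[ℂ] W} : x ∈ symSquare 𝔥 ↔ TensorProduct.comm ℂ W W x = x := by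
  change x ∈ LinearMap.ker _ ↔ _
  simp [sub_eq_zero]

theorem mem_altSquare {x : W ⊗[ℂ] W} : x ∈ altSquare 𝔥 ↔ TensorProduct.comm ℂ W W x = -x := by
  change x ∈ LinearMap.ker _ ↔ _
  simp [add_eq_zero_iff_eq_neg]

theorem tmul_self_mem_symSquare (v : W) : v ⊗ₜ[ℂ] v ∈ symSquare 𝔥 := by
  simp [mem_symSquare]

theorem add_swap_mem_symSquare (r t : W) : r ⊗ₜ[ℂ] t + t ⊗ₜ[ℂ] r ∈ symSquare 𝔥 := by
  simp [mem_symSquare, add_comm]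

theorem sub_swap_mem_altSquare (r t : W) : r ⊗ₜ[ℂ] t - t ⊗ₜ[ℂ] r ∈ altSquare 𝔥 := by
  simp [mem_altSquare]

theorem lie_tmul (D : 𝔥) (r t : W) : ⁅D, r ⊗ₜ[ℂ] t⁆ =
    (D : Module.End ℂ W) r ⊗ₜ[ℂ] t + r ⊗ₜ[ℂ] (D : Module.End ℂ W) t := rfl

theorem lie_dual_apply (D : 𝔥) (f : Module.Dual ℂ W) (w : W) :
    ⁅D, f⁆ w = -f ((D : Module.End ℂ W) w) := rfl

theorem lie_tmul_self_of_eigenvector {D : 𝔥} {v : W} {a : ℂ}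
    (h : (D : Module.End ℂ W) v = a • v) : ⁅D, v ⊗ₜ[ℂ] v⁆ = (2 * a) • v ⊗ₜ[ℂ] v := by
  rw [lie_tmul, h, TensorProduct.smul_tmul, ← two_smul ℂ, TensorProduct.tmul_smul, smul_smul]

theorem eq_zero_of_tmul_self_eq_zero {v : W} (h : v ⊗ₜ[ℂ] v = 0) : v = 0 := by
  rw [← Module.forall_dual_apply_eq_zero_iff ℂ]
  intro u
  simpa using congrArg (fun x => TensorProduct.lid ℂ ℂ (TensorProduct.map u u x)) h

end SymSquare

section Splitting

theorem eq_zero_of_add_eq_zero_of_disjoint {k L M : Type*} [CommRing k] [LieRing L]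
    [AddCommGroup M] [Module k M] [LieRingModule L M] {N N' : LieSubmodule k L M}
    (h : Disjoint N N') {x y : M} (hx : x ∈ N) (hy : y ∈ N') (hxy : x + y = 0) :
    x = 0 ∧ y = 0 := by
  have hx_zero : x = 0 :=
    Submodule.disjoint_def.1 (LieSubmodule.disjoint_toSubmodule.2 h) x hx
      (eq_neg_of_add_eq_zero_left hxy ▸ N'.neg_mem hy)
  exact ⟨hx_zero, by rwa [hx_zero, zero_add] at hxy⟩

theorem lie_eq_smul_of_lie_add_eq_smul {k L M : Type*} [CommRing k] [LieRing L]
    [AddCommGroup M] [Module k M] [LieRingModule L M] {N N' : LieSubmodule k L M}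
    (h : Disjoint N N') {x y : M} (hx : x ∈ N) (hy : y ∈ N') {D : L} {a : k}
    (hxy : ⁅D, x + y⁆ = a • (x + y)) : ⁅D, x⁆ = a • x ∧ ⁅D, y⁆ = a • y := by
  have components := eq_zero_of_add_eq_zero_of_disjoint h
    (N.sub_mem (N.lie_mem (x := D) hx) (N.smul_mem a hx))
    (N'.sub_mem (N'.lie_mem (x := D) hy) (N'.smul_mem a hy)) (by
      rw [lie_add] at hxy
      linear_combination (norm := module) hxy)
  exact ⟨sub_eq_zero.1 components.1, sub_eq_zero.1 components.2⟩

variable {W : Type u} [AddCommGroup W] [Module ℂ W]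
  {𝔥 : LieSubalgebra ℂ (Module.End ℂ W)}

theorem IsIrreducibleOrZero.exists_eq_smul {M : Type u} [AddCommGroup M] [Module ℂ M]
    [LieRingModule 𝔥 M] [LieModule ℂ 𝔥 M] [FiniteDimensional ℂ M] {N : LieSubmodule ℂ 𝔥 M}
    (hN : IsIrreducibleOrZero N) (f : M →ₗ⁅ℂ,𝔥⁆ M) (hf : ∀ x ∈ N, f x ∈ N) :
    ∃ a : ℂ, ∀ x ∈ N, f x = a • x := by
  rcases hN with rfl | hN
  · exact ⟨0, fun x hx => by rw [(LieSubmodule.mem_bot x).1 hx, map_zero, smul_zero]⟩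
  · obtain ⟨a, ha⟩ := exists_eq_smul_of_isIrreducible
      ((f.comp N.incl).codRestrict N fun x => hf x x.2)
    exact ⟨a, fun x hx => congrArg Subtype.val (ha ⟨x, hx⟩)⟩

theorem hasEigenvalue_neg_of_equiv_dual [FiniteDimensional ℂ W]
    {N : LieSubmodule ℂ 𝔥 (W ⊗[ℂ] W)} (f : N ≃ₗ⁅ℂ,𝔥⁆ Module.Dual ℂ W) {D : 𝔥} {a : ℂ}
    {x : W ⊗[ℂ] W} (hx : x ∈ N) (hx0 : x ≠ 0) (h : ⁅D, x⁆ = a • x) :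
    (D : Module.End ℂ W).HasEigenvalue (-a) := by
  refine hasEigenvalue_of_dualMap_eq_smul (y := f ⟨x, hx⟩)
    (fun h0 => hx0 (congrArg Subtype.val (f.injective (h0.trans (map_zero f.toLinearEquiv).symm))))
    ?_
  have lie_apply : ⁅D, f ⟨x, hx⟩⁆ = a • f ⟨x, hx⟩ := calc
    ⁅D, f ⟨x, hx⟩⁆ = f ⁅D, ⟨x, hx⟩⁆ := (f.toLieModuleHom.map_lie D _).symm
    _ = f (a • ⟨x, hx⟩) := congrArg f (Subtype.ext h)
    _ = a • f ⟨x, hx⟩ := map_smul f.toLinearEquiv a _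
  ext w
  have lie_apply_apply := LinearMap.congr_fun lie_apply w
  rw [lie_dual_apply, LinearMap.smul_apply] at lie_apply_apply
  rw [LinearMap.dualMap_apply, LinearMap.smul_apply, neg_smul, ← lie_apply_apply, neg_neg]

theorem finrank_eq_one_of_isIrreducible [Subsingleton 𝔥] [LieModule.IsIrreducible ℂ 𝔥 W] :
    Module.finrank ℂ W = 1 := by
  have := LieModule.nontrivial_of_isIrreducible ℂ 𝔥 W
  obtain ⟨v, hv⟩ := exists_ne (0 : W)
  let F : LieSubmodule ℂ 𝔥 W :=
    { ℂ ∙ v with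
      lie_mem := fun {D w} _ => by
        rw [Subsingleton.elim D 0, zero_lie]
        exact Submodule.zero_mem _ }
  have mem_F : v ∈ F := Submodule.mem_span_singleton_self v
  have F_eq_top : F = ⊤ := (eq_bot_or_eq_top F).resolve_left fun h =>
    hv ((LieSubmodule.mem_bot v).1 (h ▸ mem_F))
  exact finrank_eq_one v hv fun w =>
    Submodule.mem_span_singleton.1 (F_eq_top ▸ LieSubmodule.mem_top w : w ∈ F)

/-- A decomposition `S²W = U ⊕ S` with `U ≅ W*` and with `S` irreducible or zero, as provided by
`SymSquareSplits`. -/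
structure Splitting (𝔥 : LieSubalgebra ℂ (Module.End ℂ W)) where
  /-- the summand isomorphic to `W*` -/
  U : LieSubmodule ℂ 𝔥 (W ⊗[ℂ] W)
  /-- the complementary summand -/
  S : LieSubmodule ℂ 𝔥 (W ⊗[ℂ] W)
  sup_eq : U ⊔ S = symSquare 𝔥
  disjoint : Disjoint U S
  /-- the isomorphism of `U` with `W*` -/
  e : U ≃ₗ⁅ℂ,𝔥⁆ Module.Dual ℂ W
  isIrreducibleOrZero : IsIrreducibleOrZero S

namespace Splitting

variable (σ : Splitting 𝔥)

/-- The inclusion of `W* ≅ U` into `W ⊗ W`. -/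
def inclDual : Module.Dual ℂ W →ₗ⁅ℂ,𝔥⁆ W ⊗[ℂ] W :=
  σ.U.incl.comp σ.e.symm.toLieModuleHom

theorem inclDual_mem (y : Module.Dual ℂ W) : σ.inclDual y ∈ σ.U := (σ.e.symm y).2

theorem S_le : σ.S ≤ symSquare 𝔥 := σ.sup_eq ▸ le_sup_right

theorem exists_add {x : W ⊗[ℂ] W} (hx : x ∈ symSquare 𝔥) :
    ∃ y, ∃ z ∈ σ.S, σ.inclDual y + z = x := by
  rw [← σ.sup_eq, LieSubmodule.mem_sup] at hx
  obtain ⟨u, hu, z, hz, rfl⟩ := hx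
  exact ⟨σ.e ⟨u, hu⟩, z, hz, congrArg (· + z)
    (congrArg Subtype.val (σ.e.symm_apply_apply ⟨u, hu⟩))⟩

variable [FiniteDimensional ℂ W]

theorem hasEigenvalue_neg_two_mul (j : σ.S ≃ₗ⁅ℂ,𝔥⁆ Module.Dual ℂ W) {D : 𝔥} {a : ℂ}
    (ha : (D : Module.End ℂ W).HasEigenvalue a) :
    (D : Module.End ℂ W).HasEigenvalue (-2 * a) := by
  obtain ⟨v, hv⟩ := ha.exists_hasEigenvector
  obtain ⟨y, z, hz, hyz⟩ := σ.exists_add (tmul_self_mem_symSquare v)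
  obtain ⟨lie_y, lie_z⟩ := lie_eq_smul_of_lie_add_eq_smul σ.disjoint (σ.inclDual_mem y) hz
    (hyz ▸ lie_tmul_self_of_eigenvector hv.apply_eq_smul)
  rw [neg_mul]
  by_cases hy : σ.inclDual y = 0
  · refine hasEigenvalue_neg_of_equiv_dual j hz
      (fun hz0 => hv.2 (eq_zero_of_tmul_self_eq_zero ?_)) lie_z
    rw [← hyz, hy, hz0, add_zero]
  · exact hasEigenvalue_neg_of_equiv_dual σ.e (σ.inclDual_mem y) hy lie_y

variable [LieModule.IsIrreducible ℂ 𝔥 W]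

theorem S_eq_bot_of_subsingleton [Subsingleton 𝔥] : σ.S = ⊥ := by
  have finrank_W : Module.finrank ℂ W = 1 := finrank_eq_one_of_isIrreducible (𝔥 := 𝔥)
  have finrank_U : Module.finrank ℂ σ.U.toSubmodule = 1 := by
    rw [← finrank_W, ← Subspace.dual_finrank_eq (V := W)]
    exact σ.e.toLinearEquiv.finrank_eq
  have finrank_add := Submodule.finrank_add_finrank_le_of_disjoint
    (LieSubmodule.disjoint_toSubmodule.2 σ.disjoint)
  rw [finrank_U, Module.finrank_tensorProduct, finrank_W] at finrank_add
  rw [← LieSubmodule.toSubmodule_eq_bot]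
  exact Submodule.finrank_eq_zero.1 (by omega)

/-- If both summands were `W*`, an eigenvector `v ⊗ v` would turn every eigenvalue `a` of an
element of `𝔥` into an eigenvalue `-2a`, so that `𝔥` would consist of nilpotent elements. -/
theorem isEmpty_equiv_dual : IsEmpty (σ.S ≃ₗ⁅ℂ,𝔥⁆ Module.Dual ℂ W) := by
  refine ⟨fun j => ?_⟩
  have top_eq_bot : (⊤ : LieIdeal ℂ 𝔥) = ⊥ :=
    eq_bot_of_forall_isNilpotent_toEnd (M := W) fun D _ =>
      isNilpotent_of_forall_hasEigenvalue_mul (c := -2) (by norm_num)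
        fun _ => σ.hasEigenvalue_neg_two_mul j
  have : Subsingleton 𝔥 := (LieSubmodule.subsingleton_iff ℂ 𝔥 𝔥).1
    (subsingleton_of_bot_eq_top top_eq_bot.symm)
  have := LieModule.nontrivial_of_isIrreducible ℂ 𝔥 W
  obtain ⟨y, hy⟩ := exists_ne (0 : Module.Dual ℂ W)
  have symm_y : j.symm y = 0 := Subtype.ext
    ((LieSubmodule.eq_bot_iff _).1 σ.S_eq_bot_of_subsingleton _ (j.symm y).2)
  rw [← j.apply_symm_apply y, symm_y] at hy
  exact hy (map_zero j.toLinearEquiv)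

theorem apply_eq_zero_of_mem (f : W ⊗[ℂ] W →ₗ⁅ℂ,𝔥⁆ Module.Dual ℂ W) {x : W ⊗[ℂ] W}
    (hx : x ∈ σ.S) : f x = 0 := by
  rcases σ.isIrreducibleOrZero with h | h
  · rw [(LieSubmodule.mem_bot x).1 (h ▸ hx), map_zero]
  · have := isIrreducible_dual (k := ℂ) (L := 𝔥) (M := W)
    exact LieModuleHom.congr_fun
      (lieModuleHom_eq_zero_of_isEmpty_equiv σ.isEmpty_equiv_dual (f.comp σ.S.incl)) ⟨x, hx⟩

theorem eq_zero_of_forall_mem (f : Module.Dual ℂ W →ₗ⁅ℂ,𝔥⁆ W ⊗[ℂ] W)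
    (hf : ∀ y, f y ∈ σ.S) : f = 0 := by
  rcases σ.isIrreducibleOrZero with h | h
  · ext y
    exact (LieSubmodule.mem_bot _).1 (h ▸ hf y)
  · have := isIrreducible_dual (k := ℂ) (L := 𝔥) (M := W)
    have codRestrict_eq_zero := lieModuleHom_eq_zero_of_isEmpty_equiv
      ⟨fun e => σ.isEmpty_equiv_dual.elim e.symm⟩ (f.codRestrict σ.S hf)
    exact LieModuleHom.ext fun y =>
      congrArg Subtype.val (LieModuleHom.congr_fun codRestrict_eq_zero y)

end Splitting

end Splitting

/-! ### Intertwiners and the dual cubic -/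

section Intertwiners

variable {W : Type u} [AddCommGroup W] [Module ℂ W]
  {𝔥 : LieSubalgebra ℂ (Module.End ℂ W)} {C : Trilinear W}

/-- The invariant cubic `C` as an equivariant map `W ⊗ W → W*`. -/
def formHom (hi : IsInvariant 𝔥 C) : W ⊗[ℂ] W →ₗ⁅ℂ,𝔥⁆ Module.Dual ℂ W :=
  { TensorProduct.lift C with
    map_lie' := by
      intro D x
      change TensorProduct.lift C ⁅D, x⁆ = ⁅D, TensorProduct.lift C x⁆
      induction x with
      | zero => simp only [lie_zero, map_zero]
      | add x y hx hy => simp only [lie_add, map_add, hx, hy]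
      | tmul r t =>
        ext w
        rw [lie_dual_apply, lie_tmul, map_add, TensorProduct.lift.tmul, TensorProduct.lift.tmul,
          TensorProduct.lift.tmul, LinearMap.add_apply]
        linear_combination hi D.1 D.2 r t w }

@[simp] theorem formHom_tmul (hi : IsInvariant 𝔥 C) (r t : W) :
    formHom hi (r ⊗ₜ[ℂ] t) = C r t := rfl

variable [FiniteDimensional ℂ W]

/-- The identification of `W ⊗ W` with `Hom(W*, W)`. -/
def homEquiv : W ⊗[ℂ] W ≃ₗ[ℂ] (Module.Dual ℂ W →ₗ[ℂ] W) :=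
  (TensorProduct.congr (Module.evalEquiv ℂ W) (LinearEquiv.refl ℂ W)).trans
    (dualTensorHomEquiv ℂ (Module.Dual ℂ W) W)

@[simp] theorem homEquiv_tmul (r t : W) (u : Module.Dual ℂ W) :
    homEquiv (r ⊗ₜ[ℂ] t) u = u r • t := rfl

theorem homEquiv_ext {x y : W ⊗[ℂ] W}
    (h : ∀ u s : Module.Dual ℂ W, s (homEquiv x u) = s (homEquiv y u)) : x = y := by
  refine homEquiv.injective (LinearMap.ext fun u => sub_eq_zero.1 ?_)
  rw [← Module.forall_dual_apply_eq_zero_iff ℂ]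
  intro s
  rw [map_sub, h, sub_self]

theorem homEquiv_comm (x : W ⊗[ℂ] W) (u s : Module.Dual ℂ W) :
    s (homEquiv (TensorProduct.comm ℂ W W x) u) = u (homEquiv x s) := by
  induction x with
  | zero => simp
  | add x y hx hy => simp only [map_add, LinearMap.add_apply, hx, hy]
  | tmul r t => simp [mul_comm]

theorem mem_symSquare_iff_homEquiv {x : W ⊗[ℂ] W} :
    x ∈ symSquare 𝔥 ↔ ∀ u s : Module.Dual ℂ W, s (homEquiv x u) = u (homEquiv x s) := by
  rw [mem_symSquare]
  exact ⟨fun hx u s => by rw [← homEquiv_comm, hx],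
    fun h => homEquiv_ext fun u s => by rw [homEquiv_comm, h]⟩

theorem homEquiv_lie (D : 𝔥) (x : W ⊗[ℂ] W) (u : Module.Dual ℂ W) :
    homEquiv ⁅D, x⁆ u = (D : Module.End ℂ W) (homEquiv x u) +
      homEquiv x (LinearMap.dualMap (D : Module.End ℂ W) u) := by
  induction x with
  | zero => simp
  | add x y hx hy =>
    simp only [lie_add, map_add, LinearMap.add_apply, hx, hy]
    abel
  | tmul r t =>
    rw [lie_tmul, map_add, LinearMap.add_apply]
    simp [add_comm]

variable {Cd : Trilinear (Module.Dual ℂ W)}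

/-- The invariant cubic `Cd` on `W*` as an equivariant map `W* → W ⊗ W`. -/
def dualFormHom (hdi : IsDualInvariant 𝔥 Cd) : Module.Dual ℂ W →ₗ⁅ℂ,𝔥⁆ W ⊗[ℂ] W :=
  { homEquiv.symm.toLinearMap ∘ₗ contractHom Cd with
    map_lie' := by
      intro D y
      change homEquiv.symm (contractHom Cd ⁅D, y⁆) = ⁅D, homEquiv.symm (contractHom Cd y)⁆
      refine homEquiv_ext fun u s => ?_
      rw [homEquiv_lie, LinearEquiv.apply_symm_apply, LinearEquiv.apply_symm_apply, map_add]
      have apply_lie_contract : s ((D : Module.End ℂ W) (contract Cd y u)) =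
          Cd y u (LinearMap.dualMap (D : Module.End ℂ W) s) :=
        apply_contract Cd y u (LinearMap.dualMap (D : Module.End ℂ W) s)
      have lie_y : ⁅D, y⁆ = -LinearMap.dualMap (D : Module.End ℂ W) y := rfl
      have invariance := hdi D.1 D.2 y u s
      simp only [LinearMap.neg_apply, map_neg] at invariance
      simp only [contractHom_apply, apply_contract, apply_lie_contract, lie_y,
        LinearMap.neg_apply, map_neg]
      linear_combination invariance }

@[simp] theorem homEquiv_dualFormHom (hdi : IsDualInvariant 𝔥 Cd) (y u : Module.Dual ℂ W) :
    homEquiv (dualFormHom hdi y) u = contract Cd y u :=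
  LinearMap.congr_fun (homEquiv.apply_symm_apply _) u

theorem dualFormHom_mem_symSquare (hdi : IsDualInvariant 𝔥 Cd) (hCd : IsSymm Cd)
    (y : Module.Dual ℂ W) : dualFormHom hdi y ∈ symSquare 𝔥 :=
  mem_symSquare_iff_homEquiv.2 fun u s => by
    rw [homEquiv_dualFormHom, homEquiv_dualFormHom, apply_contract, apply_contract, hCd.2]

theorem dualFormHom_ne_zero (hdi : IsDualInvariant 𝔥 Cd) (hCd0 : Cd ≠ 0) :
    dualFormHom hdi ≠ 0 := by
  refine fun h => hCd0 ?_
  ext y u s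
  rw [← apply_contract, ← homEquiv_dualFormHom hdi, h]
  simp

namespace Splitting

variable (σ : Splitting 𝔥) [LieModule.IsIrreducible ℂ 𝔥 W]

theorem exists_formHom_inclDual (hC : IsSymm C) (hC0 : C ≠ 0) (hi : IsInvariant 𝔥 C) :
    ∃ k : ℂ, k ≠ 0 ∧ ∀ y, formHom hi (σ.inclDual y) = k • y := by
  have := isIrreducible_dual (k := ℂ) (L := 𝔥) (M := W)
  obtain ⟨k, hk⟩ := exists_eq_smul_of_isIrreducible ((formHom hi).comp σ.inclDual)
  refine ⟨k, ?_, hk⟩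
  rintro rfl
  refine hC0 (hC.eq_zero_of_diag fun r => ?_)
  obtain ⟨y, z, hz, hyz⟩ := σ.exists_add (tmul_self_mem_symSquare r)
  have formHom_y : formHom hi (σ.inclDual y) = 0 := (hk y).trans (zero_smul ℂ y)
  rw [← formHom_tmul hi, ← hyz, map_add, formHom_y, σ.apply_eq_zero_of_mem _ hz, add_zero,
    LinearMap.zero_apply]

theorem mem_S_of_formHom_eq_zero (hC : IsSymm C) (hC0 : C ≠ 0) (hi : IsInvariant 𝔥 C)
    {x : W ⊗[ℂ] W} (hx : x ∈ symSquare 𝔥) (h : formHom hi x = 0) : x ∈ σ.S := by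
  obtain ⟨k, hk, hky⟩ := σ.exists_formHom_inclDual hC hC0 hi
  obtain ⟨y, z, hz, rfl⟩ := σ.exists_add hx
  rw [map_add, σ.apply_eq_zero_of_mem _ hz, add_zero, hky] at h
  rwa [(smul_eq_zero.1 h).resolve_left hk, map_zero, zero_add]

theorem exists_formHom_dualFormHom (σ : Splitting 𝔥) (hC : IsSymm C) (hC0 : C ≠ 0)
    (hi : IsInvariant 𝔥 C) (hCd : IsSymm Cd) (hCd0 : Cd ≠ 0) (hdi : IsDualInvariant 𝔥 Cd) :
    ∃ k : ℂ, k ≠ 0 ∧ ∀ y, formHom hi (dualFormHom hdi y) = k • y := by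
  have := isIrreducible_dual (k := ℂ) (L := 𝔥) (M := W)
  obtain ⟨k, hk⟩ := exists_eq_smul_of_isIrreducible ((formHom hi).comp (dualFormHom hdi))
  refine ⟨k, ?_, hk⟩
  rintro rfl
  exact dualFormHom_ne_zero hdi hCd0 <| σ.eq_zero_of_forall_mem _ fun y =>
    σ.mem_S_of_formHom_eq_zero hC hC0 hi (dualFormHom_mem_symSquare hdi hCd y)
      ((hk y).trans (zero_smul ℂ y))

theorem exists_eq_smul_dualFormHom (σ : Splitting 𝔥) (hC : IsSymm C) (hC0 : C ≠ 0)
    (hi : IsInvariant 𝔥 C) (hCd : IsSymm Cd) (hCd0 : Cd ≠ 0) (hdi : IsDualInvariant 𝔥 Cd)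
    (g : Module.Dual ℂ W →ₗ⁅ℂ,𝔥⁆ W ⊗[ℂ] W) (hg : ∀ y, g y ∈ symSquare 𝔥) :
    ∃ a : ℂ, ∀ y, g y = a • dualFormHom hdi y := by
  have := isIrreducible_dual (k := ℂ) (L := 𝔥) (M := W)
  obtain ⟨k, hk, hky⟩ := σ.exists_formHom_dualFormHom hC hC0 hi hCd hCd0 hdi
  obtain ⟨a, ha⟩ := exists_eq_smul_of_isIrreducible ((formHom hi).comp g)
  refine ⟨a / k, fun y => sub_eq_zero.1 ?_⟩
  refine LieModuleHom.congr_fun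
    (σ.eq_zero_of_forall_mem (g - (a / k) • dualFormHom hdi) fun y => ?_) y
  refine σ.mem_S_of_formHom_eq_zero hC hC0 hi ((symSquare 𝔥).sub_mem (hg y)
    ((symSquare 𝔥).smul_mem _ (dualFormHom_mem_symSquare hdi hCd y))) ?_
  have formHom_g : formHom hi (g y) = a • y := ha y
  change formHom hi (g y - (a / k) • dualFormHom hdi y) = 0
  rw [map_sub, formHom_g, map_smul, hky, smul_smul, div_mul_cancel₀ _ hk, sub_self]

theorem exists_eq_smul_of_mem_S (hC : IsSymm C) (hC0 : C ≠ 0) (hi : IsInvariant 𝔥 C)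
    (f : W ⊗[ℂ] W →ₗ⁅ℂ,𝔥⁆ W ⊗[ℂ] W) (hf : ∀ x ∈ symSquare 𝔥, f x ∈ symSquare 𝔥) :
    ∃ b : ℂ, ∀ x ∈ σ.S, f x = b • x :=
  σ.isIrreducibleOrZero.exists_eq_smul f fun x hx =>
    σ.mem_S_of_formHom_eq_zero hC hC0 hi (hf x (σ.S_le hx))
      (σ.apply_eq_zero_of_mem ((formHom hi).comp f) hx)

end Splitting

end Intertwiners

section DualCubic

variable {W : Type u} [AddCommGroup W] [Module ℂ W] [FiniteDimensional ℂ W]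
  {𝔥 : LieSubalgebra ℂ (Module.End ℂ W)} {C : Trilinear W}
  {ι : Type*} [Fintype ι] (b : Module.Basis ι ℂ W)

theorem sum_coord_homEquiv (hi : IsInvariant 𝔥 C) (hC : IsSymm C) (x : W ⊗[ℂ] W) (r : W) :
    ∑ i, b.coord i (homEquiv x (C r (b i))) = formHom hi x r := by
  induction x with
  | zero => simp
  | add x y hx hy => simp only [map_add, LinearMap.add_apply, Finset.sum_add_distrib, hx, hy]
  | tmul t w =>
    have C_expand : ∑ i, b.repr w i * C r (b i) t = C r w t := by
      conv_rhs => rw [← b.sum_repr w]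
      simp only [map_sum, map_smul, LinearMap.sum_apply, LinearMap.smul_apply, smul_eq_mul]
    rw [formHom_tmul, ← hC.rotate r t w, hC.2 r t w, ← C_expand]
    refine Finset.sum_congr rfl fun i _ => ?_
    rw [homEquiv_tmul, map_smul, smul_eq_mul, mul_comm, Module.Basis.coord_apply]

theorem sum_mul_coord_homEquiv (hi : IsInvariant 𝔥 C) (hC : IsSymm C) (x : W ⊗[ℂ] W) (r : W) :
    ∑ i, ∑ j, C r (b i) (b j) * b.coord j (homEquiv x (b.coord i)) = formHom hi x r := by
  rw [← sum_coord_homEquiv b hi hC, Finset.sum_comm]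
  refine Finset.sum_congr rfl fun j _ => ?_
  have C_expand : ∑ i, C r (b i) (b j) • b.coord i = C r (b j) := by
    simp only [hC.2 r _ (b j), Module.Basis.sum_dual_apply_smul_coord]
  rw [← C_expand]
  simp only [map_sum, map_smul, smul_eq_mul]

theorem sum_mul_symmetrize {M N : Type*} [AddCommGroup M] [Module ℂ M] [AddCommGroup N]
    [Module ℂ N] {C : Trilinear M} (hC : IsSymm C) (T : Trilinear N) (x : ι → M) (y : ι → N) :
    ∑ i, ∑ j, ∑ l, C (x i) (x j) (x l) * symmetrize T (y i) (y j) (y l) =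
      ∑ i, ∑ j, ∑ l, C (x i) (x j) (x l) * T (y i) (y j) (y l) := by
  set f : ι → ι → ι → ℂ := fun i j l => C (x i) (x j) (x l) * T (y i) (y j) (y l)
  have swap_left (g : ι → ι → ι → ℂ) : ∑ i, ∑ j, ∑ l, g j i l = ∑ i, ∑ j, ∑ l, g i j l :=
    Finset.sum_comm
  have swap_right (g : ι → ι → ι → ℂ) : ∑ i, ∑ j, ∑ l, g i l j = ∑ i, ∑ j, ∑ l, g i j l :=
    Finset.sum_congr rfl fun i _ => Finset.sum_comm
  have expand (i j l : ι) : C (x i) (x j) (x l) * symmetrize T (y i) (y j) (y l) =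
      1 / 6 * (f i j l + f i l j + f j i l + f j l i + f l j i + f l i j) := by
    simp only [f, symmetrize_apply]
    rw [hC.2 (x i) (x l), hC.1 (x j) (x i), hC.1 (x l) (x j), hC.1 (x l) (x i),
      hC.2 (x j) (x l) (x i), hC.1 (x j) (x i), hC.2 (x i) (x l)]
    ring
  have sum_jli : ∑ i, ∑ j, ∑ l, f j l i = ∑ i, ∑ j, ∑ l, f i j l :=
    (swap_left fun i j l => f i l j).trans (swap_right f)
  have sum_lij : ∑ i, ∑ j, ∑ l, f l i j = ∑ i, ∑ j, ∑ l, f i j l :=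
    (swap_right fun i j l => f j i l).trans (swap_left f)
  have sum_lji : ∑ i, ∑ j, ∑ l, f l j i = ∑ i, ∑ j, ∑ l, f i j l :=
    (swap_right fun i j l => f j l i).trans sum_jli
  simp only [expand, ← Finset.mul_sum, Finset.sum_add_distrib]
  rw [swap_right f, swap_left f, sum_jli, sum_lij, sum_lji]
  ring

namespace Splitting

variable (σ : Splitting 𝔥)

/-- The trilinear form on `W*` given by the inclusion of `W*` into `S²W`. -/
def trilinear : Trilinear (Module.Dual ℂ W) :=
  (homEquiv.toLinearMap ∘ₗ (σ.inclDual : Module.Dual ℂ W →ₗ[ℂ] W ⊗[ℂ] W)).compr₂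
    (Module.evalEquiv ℂ W).toLinearMap

theorem trilinear_apply (y u s : Module.Dual ℂ W) :
    σ.trilinear y u s = s (homEquiv (σ.inclDual y) u) := rfl

theorem annihilates_trilinear (D : 𝔥) :
    Annihilates (-LinearMap.dualMap (D : Module.End ℂ W)) σ.trilinear := by
  intro y u s
  have inclDual_lie : σ.inclDual ((-LinearMap.dualMap (D : Module.End ℂ W)) y) =
      ⁅D, σ.inclDual y⁆ := σ.inclDual.map_lie D y
  rw [trilinear_apply, inclDual_lie, homEquiv_lie]
  simp only [trilinear_apply, LinearMap.neg_apply, map_add, map_neg, LinearMap.dualMap_apply]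
  ring

/-- The invariant cubic on `W*` given by the inclusion of `W*` into `S²W`. -/
def dualCubic : Trilinear (Module.Dual ℂ W) := symmetrize σ.trilinear

theorem isSymm_dualCubic : IsSymm σ.dualCubic := isSymm_symmetrize _

theorem isDualInvariant_dualCubic : IsDualInvariant 𝔥 σ.dualCubic :=
  fun D hD => (σ.annihilates_trilinear ⟨D, hD⟩).symmetrize

/-- The full contraction of `C` with `dualCubic` is the trace of the isomorphism
`W* → S²W → W*`, which is scalar. -/
theorem dualCubic_ne_zero [LieModule.IsIrreducible ℂ 𝔥 W] (hC : IsSymm C) (hC0 : C ≠ 0)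
    (hi : IsInvariant 𝔥 C) : σ.dualCubic ≠ 0 := by
  intro dualCubic_eq_zero
  have := LieModule.nontrivial_of_isIrreducible ℂ 𝔥 W
  obtain ⟨k, hk, hky⟩ := σ.exists_formHom_inclDual hC hC0 hi
  let b := Module.finBasis ℂ W
  have partial_contraction (i) : ∑ j, ∑ l, C (b i) (b j) (b l) *
      σ.trilinear (b.coord i) (b.coord j) (b.coord l) = k := by
    simp only [trilinear_apply]
    rw [sum_mul_coord_homEquiv b hi hC, hky]
    simp
  have contraction := sum_mul_symmetrize hC σ.trilinear b b.coord
  rw [show symmetrize σ.trilinear = 0 from dualCubic_eq_zero] at contraction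
  simp only [partial_contraction] at contraction
  have finrank_ne_zero : (Module.finrank ℂ W : ℂ) ≠ 0 :=
    Nat.cast_ne_zero.2 (Module.finrank_pos (R := ℂ) (M := W)).ne'
  simp [hk, finrank_ne_zero] at contraction

end Splitting

end DualCubic

/-! ### The Casimir operator of the trace form -/

section TraceProjection

theorem trace_end_eq_sum {k M ι : Type*} [Field k] [AddCommGroup M] [Module k M] [Fintype ι]
    (b : Module.Basis ι k M) (f : Module.End k (Module.End k M)) :
    LinearMap.trace k _ f =
      ∑ i, ∑ j, b.coord i (f ((b.coord j).smulRight (b i)) (b j)) := by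
  classical
  rw [LinearMap.trace_eq_matrix_trace k (b.linearMap b), Matrix.trace, Fintype.sum_prod_type]
  refine Finset.sum_congr rfl fun i _ => Finset.sum_congr rfl fun j _ => ?_
  have linearMap_eq : b.linearMap b (i, j) = (b.coord j).smulRight (b i) := b.ext fun l => by
    rw [Module.Basis.linearMap_apply_apply]
    simp [Finsupp.single_apply, eq_comm]
  rw [Matrix.diag_apply, LinearMap.toMatrix_apply, linearMap_eq,
    Module.Basis.linearMap_repr_apply]
  exact LinearMap.toMatrix_apply b b _ i j

variable {W : Type u} [AddCommGroup W] [Module ℂ W]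

/-- The orthogonal projection of `End W` onto `𝔥` with respect to the trace form, when the latter
is nondegenerate on `𝔥`. -/
structure TraceProjection (𝔥 : LieSubalgebra ℂ (Module.End ℂ W)) where
  /-- the underlying linear map -/
  toLin : Module.End ℂ W →ₗ[ℂ] Module.End ℂ W
  mem : ∀ A, toLin A ∈ 𝔥
  trace_mul : ∀ A, ∀ X ∈ 𝔥, LinearMap.trace ℂ W (toLin A * X) = LinearMap.trace ℂ W (A * X)
  nondegenerate : ∀ X ∈ 𝔥, (∀ Y ∈ 𝔥, LinearMap.trace ℂ W (X * Y) = 0) → X = 0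

variable {𝔥 : LieSubalgebra ℂ (Module.End ℂ W)}

theorem nonempty_traceProjection [FiniteDimensional ℂ W] [LieAlgebra.HasTrivialRadical ℂ 𝔥]
    [LieModule.IsIrreducible ℂ 𝔥 W] : Nonempty (TraceProjection 𝔥) := by
  have injective : Function.Injective (LieModule.traceForm ℂ 𝔥 W) :=
    (injective_iff_map_eq_zero _).2 fun _ => eq_zero_of_traceForm_eq_zero
  let B := LinearEquiv.ofBijective (LieModule.traceForm ℂ 𝔥 W)
    ⟨injective, (LinearMap.injective_iff_surjective_of_finrank_eq_finrank
      Subspace.dual_finrank_eq.symm).1 injective⟩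
  let T : Module.End ℂ W →ₗ[ℂ] Module.Dual ℂ 𝔥 :=
    ((LinearMap.mul ℂ (Module.End ℂ W)).compr₂ (LinearMap.trace ℂ W)).compl₂
      𝔥.toSubmodule.subtype
  exact ⟨{
    toLin := 𝔥.toSubmodule.subtype ∘ₗ B.symm.toLinearMap ∘ₗ T
    mem := fun A => (B.symm (T A)).2
    trace_mul := fun A X hX => LinearMap.congr_fun (B.apply_symm_apply (T A)) ⟨X, hX⟩
    nondegenerate := fun X hX h => congrArg Subtype.val
      (eq_zero_of_traceForm_eq_zero (k := ℂ) (M := W) (x := (⟨X, hX⟩ : 𝔥))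
        (LinearMap.ext fun Y => h Y.1 Y.2)) }⟩

namespace TraceProjection

variable (θ : TraceProjection 𝔥)

theorem apply_of_mem {X : Module.End ℂ W} (hX : X ∈ 𝔥) : θ.toLin X = X := by
  rw [← sub_eq_zero]
  refine θ.nondegenerate _ (𝔥.sub_mem (θ.mem X) hX) fun Y hY => ?_
  rw [sub_mul, map_sub, θ.trace_mul X Y hY, sub_self]

theorem trace_swap (A B : Module.End ℂ W) :
    LinearMap.trace ℂ W (θ.toLin A * B) = LinearMap.trace ℂ W (θ.toLin B * A) := by
  rw [LinearMap.trace_mul_comm, ← θ.trace_mul B _ (θ.mem A), LinearMap.trace_mul_comm,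
    θ.trace_mul A _ (θ.mem B), LinearMap.trace_mul_comm]

theorem apply_lie {D : Module.End ℂ W} (hD : D ∈ 𝔥) (A : Module.End ℂ W) :
    θ.toLin ⁅D, A⁆ = ⁅D, θ.toLin A⁆ := by
  rw [← sub_eq_zero]
  refine θ.nondegenerate _ (𝔥.sub_mem (θ.mem _) (𝔥.lie_mem hD (θ.mem A))) fun Y hY => ?_
  have trace_lie_mul (X : Module.End ℂ W) :
      LinearMap.trace ℂ W (⁅D, X⁆ * Y) = LinearMap.trace ℂ W (X * ⁅Y, D⁆) := by
    simp only [LieRing.of_associative_ring_bracket, sub_mul, mul_sub, map_sub, ← mul_assoc]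
    rw [LinearMap.trace_mul_cycle ℂ X Y D]
  rw [sub_mul, map_sub, θ.trace_mul _ Y hY, trace_lie_mul, trace_lie_mul,
    θ.trace_mul A _ (𝔥.lie_mem hY hD), sub_self]

theorem apply_one [LieAlgebra.HasTrivialRadical ℂ 𝔥] : θ.toLin 1 = 0 := by
  have mem_center : (⟨θ.toLin 1, θ.mem 1⟩ : 𝔥) ∈ LieAlgebra.center ℂ 𝔥 := by
    rw [LieModule.mem_maxTrivSubmodule]
    rintro ⟨D, hD⟩
    have lie_one : ⁅D, (1 : Module.End ℂ W)⁆ = 0 := by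
      rw [LieRing.of_associative_ring_bracket, mul_one, one_mul, sub_self]
    refine Subtype.ext ((θ.apply_lie hD 1).symm.trans ?_)
    rw [lie_one, map_zero]
    rfl
  rw [LieAlgebra.center_eq_bot, LieSubmodule.mem_bot] at mem_center
  exact congrArg Subtype.val mem_center

variable [FiniteDimensional ℂ W]

theorem apply_smulRight_swap (r t : W) (u s : Module.Dual ℂ W) :
    s (θ.toLin (u.smulRight t) r) = u (θ.toLin (s.smulRight r) t) := by
  have trace_mul_smulRight (A : Module.End ℂ W) (s : Module.Dual ℂ W) (r : W) :
      LinearMap.trace ℂ W (A * s.smulRight r) = s (A r) := by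
    rw [show A * s.smulRight r = s.smulRight (A r) by ext; simp, LinearMap.trace_smulRight]
  rw [← trace_mul_smulRight, θ.trace_swap, trace_mul_smulRight]

/-- The linear map underlying `TraceProjection.casimir`. -/
def casimirLin : W ⊗[ℂ] W →ₗ[ℂ] W ⊗[ℂ] W :=
  TensorProduct.lift <| LinearMap.compr₂
    (LinearMap.lflip.toLinearMap ∘ₗ LinearMap.smulRightₗ.flip.compr₂ θ.toLin).flip
    homEquiv.symm.toLinearMap

theorem homEquiv_casimirLin_tmul (r t : W) (u : Module.Dual ℂ W) :
    homEquiv (θ.casimirLin (r ⊗ₜ[ℂ] t)) u = θ.toLin (u.smulRight t) r :=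
  LinearMap.congr_fun (homEquiv.apply_symm_apply _) u

/-- The operator by which the Casimir element `∑ Xᵢ ⊗ Xⁱ` of `𝔥`, for bases dual with respect to
the trace form, acts on `W ⊗ W`. -/
def casimir : W ⊗[ℂ] W →ₗ⁅ℂ,𝔥⁆ W ⊗[ℂ] W :=
  { θ.casimirLin with
    map_lie' := by
      intro D x
      change θ.casimirLin ⁅D, x⁆ = ⁅D, θ.casimirLin x⁆
      induction x with
      | zero => simp only [lie_zero, map_zero]
      | add x y hx hy => simp only [lie_add, map_add, hx, hy]
      | tmul r t =>
        apply homEquiv.injective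
        ext u
        have lie_smulRight : ⁅(D : Module.End ℂ W), u.smulRight t⁆ =
            u.smulRight ((D : Module.End ℂ W) t) -
              (LinearMap.dualMap (D : Module.End ℂ W) u).smulRight t := by
          ext w
          simp [LieRing.of_associative_ring_bracket]
        have lie_projection := LinearMap.congr_fun (θ.apply_lie D.2 (u.smulRight t)) r
        rw [lie_smulRight, LieRing.of_associative_ring_bracket] at lie_projection
        simp only [map_sub, LinearMap.sub_apply, Module.End.mul_apply] at lie_projection
        rw [homEquiv_lie, lie_tmul]
        simp only [map_add, LinearMap.add_apply, homEquiv_casimirLin_tmul]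
        linear_combination (norm := module) lie_projection }

@[simp] theorem homEquiv_casimir_tmul (r t : W) (u : Module.Dual ℂ W) :
    homEquiv (θ.casimir (r ⊗ₜ[ℂ] t)) u = θ.toLin (u.smulRight t) r :=
  θ.homEquiv_casimirLin_tmul r t u

theorem comm_casimir (x : W ⊗[ℂ] W) :
    TensorProduct.comm ℂ W W (θ.casimir x) = θ.casimir (TensorProduct.comm ℂ W W x) := by
  induction x with
  | zero => simp
  | add x y hx hy => simp only [map_add, hx, hy]
  | tmul r t =>
    refine homEquiv_ext fun u s => ?_
    rw [homEquiv_comm, TensorProduct.comm_tmul, homEquiv_casimir_tmul, homEquiv_casimir_tmul,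
      θ.apply_smulRight_swap]

theorem casimir_mem_symSquare {x : W ⊗[ℂ] W} (hx : x ∈ symSquare 𝔥) :
    θ.casimir x ∈ symSquare 𝔥 := by
  rw [mem_symSquare, θ.comm_casimir, mem_symSquare.1 hx]

theorem casimir_mem_altSquare {x : W ⊗[ℂ] W} (hx : x ∈ altSquare 𝔥) :
    θ.casimir x ∈ altSquare 𝔥 := by
  rw [mem_altSquare, θ.comm_casimir, mem_altSquare.1 hx, map_neg]

theorem trace_eq_zero_of_casimir_eq_zero [LieAlgebra.HasTrivialRadical ℂ 𝔥]
    (h : ∀ x ∈ symSquare 𝔥, θ.casimir x = 0) : LinearMap.trace ℂ _ θ.toLin = 0 := by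
  let b := Module.finBasis ℂ W
  have apply_smulRight_eq_neg (r t : W) (u : Module.Dual ℂ W) :
      θ.toLin (u.smulRight t) r = -θ.toLin (u.smulRight r) t := by
    have casimir_add := congrArg (fun x => homEquiv x u) (h _ (add_swap_mem_symSquare r t))
    simp only [map_add, LinearMap.add_apply, homEquiv_casimir_tmul, map_zero,
      LinearMap.zero_apply] at casimir_add
    exact eq_neg_of_add_eq_zero_left casimir_add
  have sum_smulRight : ∑ j, (b.coord j).smulRight (b j) = (1 : Module.End ℂ W) := by
    ext w
    simp [LinearMap.sum_apply]
  have sum_apply_eq_zero (r : W) : ∑ j, θ.toLin ((b.coord j).smulRight r) (b j) = 0 := by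
    simp only [apply_smulRight_eq_neg _ r, Finset.sum_neg_distrib]
    rw [← LinearMap.sum_apply, ← map_sum, sum_smulRight, θ.apply_one, LinearMap.zero_apply,
      neg_zero]
  rw [trace_end_eq_sum b]
  simp only [← map_sum, sum_apply_eq_zero, map_zero, Finset.sum_const_zero]

/-- The projection is an idempotent of trace zero, hence vanishes. -/
theorem subsingleton_of_casimir_eq_zero [LieAlgebra.HasTrivialRadical ℂ 𝔥]
    (h : ∀ x ∈ symSquare 𝔥, θ.casimir x = 0) : Subsingleton 𝔥 := by
  have idempotent : IsIdempotentElem θ.toLin :=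
    LinearMap.ext fun A => θ.apply_of_mem (θ.mem A)
  have toLin_eq_zero : θ.toLin = 0 := LinearMap.IsIdempotentElem.eq_zero_of_trace_eq_zero
    idempotent (θ.trace_eq_zero_of_casimir_eq_zero h)
  refine subsingleton_of_forall_eq 0 fun D => Subtype.ext ?_
  rw [← θ.apply_of_mem D.2, toLin_eq_zero]
  rfl

end TraceProjection

end TraceProjection

/-! ### The quartic identity in the irreducible case -/

section CasimirRelation

variable {W : Type u} [AddCommGroup W] [Module ℂ W]
  {𝔥 : LieSubalgebra ℂ (Module.End ℂ W)} {C : Trilinear W} {Cd : Trilinear (Module.Dual ℂ W)}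

theorem IsDualInvariant.smul (hdi : IsDualInvariant 𝔥 Cd) (c : ℂ) :
    IsDualInvariant 𝔥 (c • Cd) := by
  intro D hD x y z
  simp only [LinearMap.smul_apply, smul_eq_mul]
  linear_combination c * hdi D hD x y z

theorem eq_zero_of_annihilates_smulRight_add (hC : IsSymm C) (hC0 : C ≠ 0) {p q : ℂ}
    (h : ∀ (t : W) (u : Module.Dual ℂ W),
      Annihilates (p • u.smulRight t + (q * u t) • LinearMap.id) C)
    (t : W) (u : Module.Dual ℂ W) : p • u.smulRight t + (q * u t) • LinearMap.id = 0 := by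
  obtain ⟨r, hr⟩ := hC.exists_diag_ne_zero hC0
  have smul_r_add_smul (t : W) : (p * C r r t) • r + (q * C r r r) • t = 0 := by
    rw [← Module.forall_dual_apply_eq_zero_iff ℂ]
    intro u
    have annihilation := (h t u).apply_diag hC r
    simp only [LinearMap.add_apply, LinearMap.smul_apply, LinearMap.smulRight_apply,
      LinearMap.id_apply, map_add, map_smul, smul_eq_mul, hC.rotate t r r] at annihilation
    simp only [map_add, map_smul, smul_eq_mul]
    linear_combination annihilation
  have q_eq : q = -p := by
    have r_ne_zero : r ≠ 0 := by
      rintro rfl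
      simp at hr
    have smul_r := smul_r_add_smul r
    rw [← add_smul, ← add_mul] at smul_r
    have sum_eq_zero := (mul_eq_zero.1 ((smul_eq_zero.1 smul_r).resolve_right r_ne_zero))
    exact eq_neg_of_add_eq_zero_right (sum_eq_zero.resolve_right hr)
  subst q_eq
  ext w
  have smul_t := smul_r_add_smul t
  have smul_w := smul_r_add_smul w
  have apply_t := congrArg u smul_t
  have apply_w := congrArg u smul_w
  simp only [map_add, map_smul, smul_eq_mul, map_zero] at apply_t apply_w
  have coeff_r : C r r r * p * (u w * C r r t - u t * C r r w) = 0 := by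
    linear_combination C r r w * apply_t - C r r t * apply_w
  refine (smul_eq_zero.1 ?_).resolve_left (pow_ne_zero 2 hr)
  simp only [LinearMap.add_apply, LinearMap.smul_apply, LinearMap.smulRight_apply,
    LinearMap.id_apply]
  linear_combination (norm := module)
    coeff_r • r - (C r r r * u w) • smul_t + (C r r r * u t) • smul_w

theorem SharpIdentity.smul_injective {l : ℂ} (hC : IsSymm C) (hC0 : C ≠ 0)
    (hl : l ≠ 0) {a b : ℂ} (ha : SharpIdentity C (a • Cd) l)
    (hb : SharpIdentity C (b • Cd) l) : a = b := by
  obtain ⟨r, hr⟩ := hC.exists_diag_ne_zero hC0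
  have apply_a := ha r (C r r)
  have apply_b := hb r (C r r)
  simp only [LinearMap.smul_apply, smul_eq_mul] at apply_a apply_b
  refine mul_right_cancel₀ (fun h => ?_) (apply_a.trans apply_b.symm)
  rw [h, mul_zero] at apply_a
  exact mul_ne_zero (mul_ne_zero hl hr) hr apply_a.symm

variable [FiniteDimensional ℂ W]

/-- On `S²W`, the composite `S²W → W* → S²W` of the two cubics is the combination `l + m θ.casimir`
of the identity and of the Casimir operator. -/
def CasimirRelation (θ : TraceProjection 𝔥) (hi : IsInvariant 𝔥 C) (hdi : IsDualInvariant 𝔥 Cd)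
    (l m : ℂ) : Prop :=
  ∀ x ∈ symSquare 𝔥, dualFormHom hdi (formHom hi x) = l • x + m • θ.casimir x

section Consequences

variable {θ : TraceProjection 𝔥} {hi : IsInvariant 𝔥 C} {hdi : IsDualInvariant 𝔥 Cd} {l m : ℂ}

theorem CasimirRelation.smul (h : CasimirRelation θ hi hdi l m) (c : ℂ) :
    CasimirRelation θ hi (hdi.smul c) (c * l) (c * m) := by
  intro x hx
  have dualFormHom_smul (y : Module.Dual ℂ W) :
      dualFormHom (hdi.smul c) y = c • dualFormHom hdi y := homEquiv_ext fun u s => by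
    simp only [map_smul, LinearMap.smul_apply, homEquiv_dualFormHom, apply_contract]
  rw [dualFormHom_smul, h x hx, smul_add, smul_smul, smul_smul]

theorem CasimirRelation.two_smul_contract (h : CasimirRelation θ hi hdi l m) (hC : IsSymm C)
    (r t : W) (u : Module.Dual ℂ W) :
    (2 : ℂ) • contract Cd (C r t) u = l • (u r • t + u t • r) +
      m • (θ.toLin (u.smulRight t) r + θ.toLin (u.smulRight r) t) := by
  have relation := congrArg (fun x => homEquiv x u) (h _ (add_swap_mem_symSquare r t))
  simp only [map_add, LinearMap.add_apply, map_smul, LinearMap.smul_apply, homEquiv_dualFormHom,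
    formHom_tmul, TraceProjection.homEquiv_casimir_tmul, homEquiv_tmul,
    hC.apply_comm t r] at relation
  rw [← relation, two_smul]

theorem CasimirRelation.sharpIdentity (h : CasimirRelation θ hi hdi l m) (hC : IsSymm C)
    (hCd : IsSymm Cd) : SharpIdentity C Cd l := by
  intro r s
  have relation := congrArg (C r r) (h.two_smul_contract hC r r s)
  simp only [map_add, map_smul, smul_eq_mul, apply_contract] at relation
  have annihilation := (hi _ (θ.mem (s.smulRight r))).apply_diag hC r
  rw [hC.rotate] at annihilation
  linear_combination (1 / 2 : ℂ) * relation + hCd.2 (C r r) (C r r) s + m * annihilation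

theorem CasimirRelation.dualSharpIdentity (h : CasimirRelation θ hi hdi l m) (hC : IsSymm C)
    (hCd : IsSymm Cd) : DualSharpIdentity C Cd l := by
  intro r s
  set t := contract Cd s s with ht
  have relation := congrArg s (h.two_smul_contract hC r t s)
  have annihilation := (hdi _ (θ.mem (s.smulRight r))).apply_diag hCd s
  have apply_t : s (θ.toLin (s.smulRight r) t) =
      Cd (LinearMap.dualMap (θ.toLin (s.smulRight r)) s) s s := by
    rw [hCd.rotate]
    exact apply_contract Cd s s (LinearMap.dualMap (θ.toLin (s.smulRight r)) s)
  have C_t : C t t r = Cd (C r t) s s := by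
    rw [hC.2, hC.1, ht, apply_contract, hCd.2, hCd.1]
  have s_t : s t = Cd s s s := by rw [ht, apply_contract]
  simp only [LinearMap.neg_apply, map_neg] at annihilation
  simp only [map_add, map_smul, smul_eq_mul, apply_contract] at relation
  rw [C_t, ← s_t]
  linear_combination (1 / 2 : ℂ) * relation + m / 2 * θ.apply_smulRight_swap r t s s +
    m * apply_t - m * annihilation

theorem CasimirRelation.exists_contract_eq (h : CasimirRelation θ hi hdi l m) (hC : IsSymm C)
    (halt : IsIrreducibleOrZero (altSquare 𝔥)) :
    ∃ p q : ℂ, ∀ (r t : W) (u : Module.Dual ℂ W), contract Cd (C r t) u =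
      m • θ.toLin (u.smulRight t) r + (p * u r) • t + (q * u t) • r := by
  obtain ⟨d, hd⟩ := halt.exists_eq_smul θ.casimir fun _ => θ.casimir_mem_altSquare
  refine ⟨(l - m * d) / 2, (l + m * d) / 2, fun r t u => ?_⟩
  have casimir_alt := congrArg (fun x => homEquiv x u) (hd _ (sub_swap_mem_altSquare r t))
  simp only [map_sub, LinearMap.sub_apply, map_smul, LinearMap.smul_apply,
    TraceProjection.homEquiv_casimir_tmul, homEquiv_tmul] at casimir_alt
  linear_combination (norm := module)
    (1 / 2 : ℂ) • h.two_smul_contract hC r t u - (m / 2) • casimir_alt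

theorem CasimirRelation.dOp_mem (h : CasimirRelation θ hi hdi 2 m) (hC : IsSymm C) (hC0 : C ≠ 0)
    (hCd : IsSymm Cd) (halt : IsIrreducibleOrZero (altSquare 𝔥)) (t : W) (a : Module.Dual ℂ W) :
    dOp C Cd t a ∈ 𝔥 := by
  obtain ⟨p, q, contract_eq⟩ := h.exists_contract_eq hC halt
  have projection_mem (t : W) (a : Module.Dual ℂ W) : -(m • θ.toLin (a.smulRight t)) ∈ 𝔥 :=
    𝔥.neg_mem (𝔥.smul_mem _ (θ.mem _))
  have dOp_eq (t : W) (a : Module.Dual ℂ W) : dOp C Cd t a = -(m • θ.toLin (a.smulRight t)) +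
      ((3 / 2 - p) • a.smulRight t + ((1 / 2 - q) * a t) • LinearMap.id) := by
    ext w
    rw [dOp_apply, contract_eq]
    simp only [LinearMap.add_apply, LinearMap.smul_apply, LinearMap.smulRight_apply,
      LinearMap.id_apply, LinearMap.neg_apply]
    module
  have annihilates (t : W) (a : Module.Dual ℂ W) :
      Annihilates ((3 / 2 - p) • a.smulRight t + ((1 / 2 - q) * a t) • LinearMap.id) C := by
    rw [← sub_eq_iff_eq_add'.2 (dOp_eq t a)]
    exact (stabilizer C).sub_mem ((h.sharpIdentity hC hCd).annihilates_dOp hC hCd t a)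
      (hi _ (projection_mem t a))
  rw [dOp_eq, eq_zero_of_annihilates_smulRight_add hC hC0 annihilates, add_zero]
  exact projection_mem t a

theorem CasimirRelation.qIsInvariant (h : CasimirRelation θ hi hdi 2 m) (hC : IsSymm C)
    (hCd : IsSymm Cd) : QIsInvariant 𝔥 C Cd :=
  qIsInvariant_of_sharpIdentity hC hCd hi hdi (h.sharpIdentity hC hCd)
    (h.dualSharpIdentity hC hCd)

end Consequences

/-- On the line spanned by `r ⊗ r` the Casimir operator pairs to `C(Dr, r, r)` with `D ∈ 𝔥`. -/
theorem TraceProjection.eq_zero_of_casimir_eq_smul (θ : TraceProjection 𝔥) (hC : IsSymm C)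
    (hC0 : C ≠ 0) (hi : IsInvariant 𝔥 C) {b : ℂ}
    (h : ∀ x ∈ symSquare 𝔥, θ.casimir x = b • x) : b = 0 := by
  obtain ⟨r, hr⟩ := hC.exists_diag_ne_zero hC0
  have pairing := congrArg (fun x => C r r (homEquiv x (C r r))) (h _ (tmul_self_mem_symSquare r))
  simp only [homEquiv_casimir_tmul, map_smul, LinearMap.smul_apply, homEquiv_tmul,
    smul_eq_mul] at pairing
  have annihilation := (hi _ (θ.mem ((C r r).smulRight r))).apply_diag hC r
  rw [hC.rotate, pairing] at annihilation
  exact (mul_eq_zero.1 annihilation).resolve_right (mul_ne_zero hr hr)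

section Existence

variable [LieModule.IsIrreducible ℂ 𝔥 W]

theorem SharpIdentity.ne_zero {l : ℂ} (h : SharpIdentity C Cd l) (σ : Splitting 𝔥)
    (hC : IsSymm C) (hC0 : C ≠ 0) (hi : IsInvariant 𝔥 C) (hCd : IsSymm Cd) (hCd0 : Cd ≠ 0)
    (hdi : IsDualInvariant 𝔥 Cd) : l ≠ 0 := by
  rintro rfl
  obtain ⟨k, hk, hky⟩ := σ.exists_formHom_dualFormHom hC hC0 hi hCd hCd0 hdi
  obtain ⟨r, hr⟩ := hC.exists_diag_ne_zero hC0
  let b := Module.finBasis ℂ W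
  have coord_contract (i) : b.coord i (contract Cd (C r r) (C r (b i))) = 0 := by
    rw [apply_contract, hCd.1]
    linear_combination (1 / 4 : ℂ) * h.polar hC hCd r (b i) (b.coord i)
  have sum_coord := sum_coord_homEquiv b hi hC (dualFormHom hdi (C r r)) r
  simp only [homEquiv_dualFormHom, coord_contract, Finset.sum_const_zero, hky] at sum_coord
  exact mul_ne_zero hk hr sum_coord.symm

namespace Splitting

theorem sub_smul_mem_S (σ : Splitting 𝔥) (hC : IsSymm C) (hC0 : C ≠ 0)
    (hi : IsInvariant 𝔥 C) (hCd : IsSymm Cd) (hdi : IsDualInvariant 𝔥 Cd) {k : ℂ} (hk : k ≠ 0)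
    (hky : ∀ y, formHom hi (dualFormHom hdi y) = k • y) {x : W ⊗[ℂ] W} (hx : x ∈ symSquare 𝔥) :
    x - k⁻¹ • dualFormHom hdi (formHom hi x) ∈ σ.S := by
  refine σ.mem_S_of_formHom_eq_zero hC hC0 hi ((symSquare 𝔥).sub_mem hx
    ((symSquare 𝔥).smul_mem _ (dualFormHom_mem_symSquare hdi hCd _))) ?_
  rw [map_sub, map_smul, hky, smul_smul, inv_mul_cancel₀ hk, one_smul, sub_self]

theorem exists_casimir_eq (σ : Splitting 𝔥) (θ : TraceProjection 𝔥) (hC : IsSymm C)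
    (hC0 : C ≠ 0) (hi : IsInvariant 𝔥 C) (hCd : IsSymm Cd) (hCd0 : Cd ≠ 0)
    (hdi : IsDualInvariant 𝔥 Cd) :
    ∃ b c : ℂ, ∀ x ∈ symSquare 𝔥,
      θ.casimir x = b • x + c • dualFormHom hdi (formHom hi x) := by
  obtain ⟨k, hk, hky⟩ := σ.exists_formHom_dualFormHom hC hC0 hi hCd hCd0 hdi
  obtain ⟨a, ha⟩ := σ.exists_eq_smul_dualFormHom hC hC0 hi hCd hCd0 hdi
    (θ.casimir.comp (dualFormHom hdi)) fun y =>
      θ.casimir_mem_symSquare (dualFormHom_mem_symSquare hdi hCd y)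
  obtain ⟨b, hb⟩ := σ.exists_eq_smul_of_mem_S hC hC0 hi θ.casimir
    fun _ => θ.casimir_mem_symSquare
  refine ⟨b, k⁻¹ * (a - b), fun x hx => ?_⟩
  have on_S := hb _ (σ.sub_smul_mem_S hC hC0 hi hCd hdi hk hky hx)
  have on_dual := ha (formHom hi x)
  rw [LieModuleHom.comp_apply] at on_dual
  rw [map_sub, map_smul, on_dual] at on_S
  linear_combination (norm := module) on_S

variable [LieAlgebra.HasTrivialRadical ℂ 𝔥]

theorem S_eq_bot_of_casimir_eq_smul (σ : Splitting 𝔥) (θ : TraceProjection 𝔥)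
    (hC : IsSymm C) (hC0 : C ≠ 0) (hi : IsInvariant 𝔥 C) {b : ℂ}
    (h : ∀ x ∈ symSquare 𝔥, θ.casimir x = b • x) : σ.S = ⊥ := by
  have b_eq_zero := θ.eq_zero_of_casimir_eq_smul hC hC0 hi h
  have := θ.subsingleton_of_casimir_eq_zero fun x hx => by rw [h x hx, b_eq_zero, zero_smul]
  exact σ.S_eq_bot_of_subsingleton

theorem exists_casimirRelation (σ : Splitting 𝔥) (θ : TraceProjection 𝔥) (hC : IsSymm C)
    (hC0 : C ≠ 0) (hi : IsInvariant 𝔥 C) (hCd : IsSymm Cd) (hCd0 : Cd ≠ 0)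
    (hdi : IsDualInvariant 𝔥 Cd) :
    ∃ l m : ℂ, CasimirRelation θ hi hdi l m := by
  obtain ⟨b, c, casimir_eq⟩ := σ.exists_casimir_eq θ hC hC0 hi hCd hCd0 hdi
  rcases eq_or_ne c 0 with rfl | hc
  · obtain ⟨k, hk, hky⟩ := σ.exists_formHom_dualFormHom hC hC0 hi hCd hCd0 hdi
    have S_eq_bot := σ.S_eq_bot_of_casimir_eq_smul θ hC hC0 hi fun x hx => by
      rw [casimir_eq x hx, zero_smul, add_zero]
    refine ⟨k, 0, fun x hx => ?_⟩
    have mem_S := σ.sub_smul_mem_S hC hC0 hi hCd hdi hk hky hx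
    rw [S_eq_bot, LieSubmodule.mem_bot, sub_eq_zero] at mem_S
    rw [zero_smul, add_zero, ← inv_smul_eq_iff₀ hk, ← mem_S]
  · refine ⟨-(c⁻¹ * b), c⁻¹, fun x hx => ?_⟩
    rw [casimir_eq x hx, smul_add, inv_smul_smul₀ hc]
    module

end Splitting

theorem exists_invariant_quartic [LieAlgebra.HasTrivialRadical ℂ 𝔥]
    (hsplit : SymSquareSplits 𝔥) (hC : IsSymm C)
    (hC0 : C ≠ 0) (hi : IsInvariant 𝔥 C) :
    (∃ Cd : Trilinear (Module.Dual ℂ W), IsSymm Cd ∧ Cd ≠ 0 ∧ IsDualInvariant 𝔥 Cd) ∧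
      ∀ Cd : Trilinear (Module.Dual ℂ W), IsSymm Cd → Cd ≠ 0 → IsDualInvariant 𝔥 Cd →
        ∃ c : ℂ, c ≠ 0 ∧ QIsInvariant 𝔥 C (c • Cd) ∧
          ((IsIrreducibleOrZero (altSquare 𝔥) ∨ 𝔥 = stabilizer C) → IsLieAction 𝔥 C (c • Cd)) ∧
          ∀ c' : ℂ, (QIsInvariant 𝔥 C (c' • Cd) ∨ IsLieAction 𝔥 C (c' • Cd)) → c' = c := by
  obtain ⟨U, S, hUS, hd, ⟨e⟩, hS⟩ := hsplit
  let σ : Splitting 𝔥 := ⟨U, S, hUS, hd, e, hS⟩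
  obtain ⟨θ⟩ := nonempty_traceProjection (𝔥 := 𝔥)
  refine ⟨⟨σ.dualCubic, σ.isSymm_dualCubic, σ.dualCubic_ne_zero hC hC0 hi,
    σ.isDualInvariant_dualCubic⟩, fun Cd hCd hCd0 hdi => ?_⟩
  obtain ⟨l, m, relation⟩ := σ.exists_casimirRelation θ hC hC0 hi hCd hCd0 hdi
  have hl : l ≠ 0 := (relation.sharpIdentity hC hCd).ne_zero σ hC hC0 hi hCd hCd0 hdi
  have normalized := relation.smul (2 / l)
  rw [div_mul_cancel₀ _ hl] at normalized
  have sharp := normalized.sharpIdentity hC (hCd.smul _)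
  refine ⟨2 / l, div_ne_zero two_ne_zero hl, normalized.qIsInvariant hC (hCd.smul _), ?_, ?_⟩
  · intro h
    refine isLieAction_of_dOp_mem (fun t a => ?_) hC (hCd.smul _) hi (hdi.smul _)
    rcases h with halt | rfl
    · exact normalized.dOp_mem hC hC0 (hCd.smul _) halt t a
    · exact sharp.annihilates_dOp hC (hCd.smul _) t a
  · rintro c' (h | h)
    · exact (h.sharpIdentity hC (hCd.smul _)).smul_injective hC hC0 two_ne_zero sharp
    · exact (h.sharpIdentity hC (hCd.smul _) hi).smul_injective hC hC0 two_ne_zero sharp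

end Existence

end CasimirRelation

/-! ### Cubics with an adjoint -/

section Stabilizer

theorem exists_polynomial_diag_line {M : Type*} [AddCommGroup M] [Module ℂ M] (E : Trilinear M)
    (x y : M) : ∃ p : Polynomial ℂ, ∀ z : ℂ, p.eval z = E (x + z • y) (x + z • y) (x + z • y) := by
  refine ⟨Polynomial.C (E x x x) +
    Polynomial.C (E y x x + E x y x + E x x y) * Polynomial.X +
    Polynomial.C (E y y x + E y x y + E x y y) * Polynomial.X ^ 2 +
    Polynomial.C (E y y y) * Polynomial.X ^ 3, fun z => ?_⟩
  simp only [Polynomial.eval_add, Polynomial.eval_mul, Polynomial.eval_pow, Polynomial.eval_C,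
    Polynomial.eval_X, map_add, map_smul, LinearMap.add_apply, LinearMap.smul_apply, smul_eq_mul]
  ring

theorem diag_eq_zero_or_diag_eq_zero {M : Type*} [AddCommGroup M] [Module ℂ M]
    {E F : Trilinear M} (h : ∀ x, E x x x * F x x x = 0) :
    (∀ x, E x x x = 0) ∨ ∀ x, F x x x = 0 := by
  by_contra! hne
  obtain ⟨⟨y, hy⟩, x, hx⟩ := hne
  obtain ⟨p, hp⟩ := exists_polynomial_diag_line E x (y - x)
  obtain ⟨q, hq⟩ := exists_polynomial_diag_line F x (y - x)
  have p_mul_q : p * q = 0 := Polynomial.funext fun z => by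
    rw [Polynomial.eval_mul, hp, hq, h, Polynomial.eval_zero]
  rcases mul_eq_zero.1 p_mul_q with rfl | rfl
  · have eval_one := hp 1
    rw [one_smul, add_sub_cancel, Polynomial.eval_zero] at eval_one
    exact hy eval_one.symm
  · have eval_zero := hq 0
    rw [zero_smul, add_zero, Polynomial.eval_zero] at eval_zero
    exact hx eval_zero.symm

variable {W : Type u} [AddCommGroup W] [Module ℂ W] [FiniteDimensional ℂ W]
  {C : Trilinear W} {Cd : Trilinear (Module.Dual ℂ W)}

/-- Differentiating the identity `C(Cd(s²)²) = 2 Cd(s³) s` along `D` shows that the cubic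
`Cd(s, s, Dᵀs)` times `Cd(s³)` vanishes. -/
theorem DualSharpIdentity.isDualInvariant_stabilizer (h : DualSharpIdentity C Cd 2)
    (hC : IsSymm C) (hCd : IsSymm Cd) : IsDualInvariant (stabilizer C) Cd := by
  intro D hD
  let F : Trilinear (Module.Dual ℂ W) := Cd.compr₂ (LinearMap.lcomp ℂ ℂ (LinearMap.dualMap D))
  have F_apply (s) : F s s s = s (D (contract Cd s s)) := (apply_contract Cd s s _).symm
  have Cd_mul_F (s) : Cd s s s * F s s s = 0 := by
    have annihilation := Annihilates.apply_diag hD hC (contract Cd s s)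
    rw [hC.rotate, h, ← F_apply] at annihilation
    linear_combination (1 / 2 : ℂ) * annihilation
  have apply_neg_dualMap (s) : Cd (-(LinearMap.dualMap D) s) s s = -F s s s := by
    rw [map_neg, LinearMap.neg_apply, LinearMap.neg_apply, hCd.rotate]
    rfl
  refine hCd.annihilates_of_diag fun s => ?_
  rw [LinearMap.neg_apply, apply_neg_dualMap, neg_eq_zero]
  rcases diag_eq_zero_or_diag_eq_zero Cd_mul_F with hzero | hzero
  · rw [F_apply, contract, hCd.eq_zero_of_diag hzero, LinearMap.zero_apply, LinearMap.zero_apply,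
      map_zero, map_zero, map_zero]
  · exact hzero s

theorem isLieAction_stabilizer (hC : IsSymm C) (hCd : IsSymm Cd) (h : SharpIdentity C Cd 2)
    (hd : DualSharpIdentity C Cd 2) : IsLieAction (stabilizer C) C Cd :=
  isLieAction_of_dOp_mem (h.annihilates_dOp hC hCd) hC hCd (fun _ hD => hD)
    (hd.isDualInvariant_stabilizer hC hCd)

theorem qIsInvariant_stabilizer (hC : IsSymm C) (hCd : IsSymm Cd) (h : SharpIdentity C Cd 2)
    (hd : DualSharpIdentity C Cd 2) : QIsInvariant (stabilizer C) C Cd :=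
  qIsInvariant_of_sharpIdentity hC hCd (fun _ hD => hD) (hd.isDualInvariant_stabilizer hC hCd) h hd

end Stabilizer

section Adjoint

variable {W : Type u} [AddCommGroup W] [Module ℂ W] {C : Trilinear W}
  {T : LinearMap.BilinForm ℂ W} {sharp : W → W}

/-- `sharp` is the adjoint `X ↦ X^#` of the cubic `C` with respect to the trace form `T`, as for
the determinant of a Jordan algebra of degree three. -/
structure IsCubicAdjoint (C : Trilinear W) (T : LinearMap.BilinForm ℂ W) (sharp : W → W) :
    Prop where
  trace_comm : ∀ X Y, T X Y = T Y X
  nondegenerate : T.Nondegenerate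
  apply_apply : ∀ X Y, C X X Y = 1 / 3 * T (sharp X) Y
  sharp_sharp : ∀ X, sharp (sharp X) = C X X X • X

variable [FiniteDimensional ℂ W]

namespace IsCubicAdjoint

/-- The dual of a cubic with an adjoint: up to the factor that makes the constants in the two
quartic identities equal to `2`, the same cubic transported to `W*` by the trace form. -/
def dualCubic (h : IsCubicAdjoint C T sharp) : Trilinear (Module.Dual ℂ W) :=
  let ψ := (T.toDual h.nondegenerate).symm.toLinearMap
  (54 : ℂ) • (C.compl₁₂ ψ ψ).compr₂ (LinearMap.lcomp ℂ ℂ ψ)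

variable (h : IsCubicAdjoint C T sharp)

theorem dualCubic_apply (s t u : Module.Dual ℂ W) :
    h.dualCubic s t u = 54 * C ((T.toDual h.nondegenerate).symm s)
      ((T.toDual h.nondegenerate).symm t) ((T.toDual h.nondegenerate).symm u) := rfl

theorem isSymm_dualCubic (hC : IsSymm C) : IsSymm h.dualCubic :=
  ⟨fun s t u => by rw [dualCubic_apply, dualCubic_apply, hC.1],
    fun s t u => by rw [dualCubic_apply, dualCubic_apply, hC.2]⟩

theorem dualCubic_ne_zero (hC0 : C ≠ 0) : h.dualCubic ≠ 0 := by
  refine fun h0 => hC0 ?_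
  ext X Y Z
  have apply_toDual := h.dualCubic_apply (T.toDual h.nondegenerate X) (T.toDual h.nondegenerate Y)
    (T.toDual h.nondegenerate Z)
  simpa only [h0, LinearMap.zero_apply, LinearEquiv.symm_apply_apply, zero_eq_mul,
    OfNat.ofNat_ne_zero, false_or] using apply_toDual

theorem toDual_symm_apply_apply (X : W) :
    (T.toDual h.nondegenerate).symm (C X X) = (1 / 3 : ℂ) • sharp X := by
  rw [LinearEquiv.symm_apply_eq]
  ext Y
  rw [LinearMap.BilinForm.toDual_def, h.apply_apply, map_smul, LinearMap.smul_apply, smul_eq_mul]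

theorem contract_dualCubic (s : Module.Dual ℂ W) :
    contract h.dualCubic s s = (18 : ℂ) • sharp ((T.toDual h.nondegenerate).symm s) := by
  rw [← sub_eq_zero, ← Module.forall_dual_apply_eq_zero_iff ℂ]
  intro u
  rw [map_sub, apply_contract, dualCubic_apply, h.apply_apply, h.trace_comm,
    LinearMap.BilinForm.apply_toDual_symm_apply, map_smul, smul_eq_mul]
  ring

theorem sharpIdentity : SharpIdentity C h.dualCubic 2 := fun X s => by
  rw [dualCubic_apply, h.toDual_symm_apply_apply]
  simp only [map_smul, LinearMap.smul_apply, smul_eq_mul]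
  rw [h.apply_apply, h.sharp_sharp, map_smul, LinearMap.smul_apply, smul_eq_mul, h.trace_comm,
    LinearMap.BilinForm.apply_toDual_symm_apply]
  ring

theorem dualSharpIdentity : DualSharpIdentity C h.dualCubic 2 := fun X s => by
  rw [contract_dualCubic, dualCubic_apply]
  simp only [map_smul, LinearMap.smul_apply, smul_eq_mul]
  rw [h.apply_apply, h.sharp_sharp, map_smul, LinearMap.smul_apply, smul_eq_mul,
    LinearMap.BilinForm.apply_toDual_symm_apply]
  ring

theorem isDualInvariant (hC : IsSymm C) : IsDualInvariant (stabilizer C) h.dualCubic :=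
  h.dualSharpIdentity.isDualInvariant_stabilizer hC (h.isSymm_dualCubic hC)

theorem isLieAction (hC : IsSymm C) : IsLieAction (stabilizer C) C h.dualCubic :=
  isLieAction_stabilizer hC (h.isSymm_dualCubic hC) h.sharpIdentity h.dualSharpIdentity

theorem qIsInvariant (hC : IsSymm C) : QIsInvariant (stabilizer C) C h.dualCubic :=
  qIsInvariant_stabilizer hC (h.isSymm_dualCubic hC) h.sharpIdentity h.dualSharpIdentity

end IsCubicAdjoint

end Adjoint

/-! ### Composition algebras and Hermitian matrices -/

section Composition

open QuadraticMap (polar polar_add_left polar_add_right polar_comm polar_neg_right polar_self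
  polar_smul_left polar_smul_right polar_sub_left polar_sub_right)

variable {A : Type v} [NonAssocRing A] [Module ℂ A] {N : QuadraticForm ℂ A}

theorem norm_sub (x y : A) : N (x - y) = N x + N y - polar N x y := by
  rw [sub_eq_add_neg, QuadraticMap.map_add N, QuadraticMap.map_neg, polar_neg_right]
  ring

theorem conj_add (x y : A) : conj N (x + y) = conj N x + conj N y := by
  simp only [conj, trace, polar_add_left, add_smul]
  abel

theorem conj_smul (c : ℂ) (x : A) : conj N (c • x) = c • conj N x := by
  simp only [conj, trace, polar_smul_left, smul_sub, smul_assoc]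

theorem conj_sub (x y : A) : conj N (x - y) = conj N x - conj N y := by
  simp only [conj, trace, polar_sub_left, sub_smul]
  abel

namespace IsCompositionNorm

theorem ext (hN : IsCompositionNorm N) {x y : A} (h : ∀ w, polar N x w = polar N y w) : x = y :=
  sub_eq_zero.1 <| hN.nondegenerate _ fun w => by rw [polar_sub_left, h, sub_self]

theorem polar_mul_right_mul_right (hN : IsCompositionNorm N) (x y z : A) :
    polar N (x * z) (y * z) = polar N x y * N z := by
  simp only [polar, ← add_mul, hN.map_mul]
  ring

theorem polar_mul_left_mul_left (hN : IsCompositionNorm N) (x y z : A) :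
    polar N (z * x) (z * y) = N z * polar N x y := by
  simp only [polar, ← mul_add, hN.map_mul]
  ring

theorem polar_mul_mul_add (hN : IsCompositionNorm N) (x y z w : A) :
    polar N (x * y) (z * w) + polar N (x * w) (z * y) = polar N x z * polar N y w := by
  have expansion := hN.polar_mul_right_mul_right x z (y + w)
  simp only [mul_add, polar_add_left, polar_add_right,
    QuadraticMap.map_add N y w] at expansion
  linear_combination expansion - hN.polar_mul_right_mul_right x z y -
    hN.polar_mul_right_mul_right x z w

theorem norm_one_eq_one_or_subsingleton (hN : IsCompositionNorm N) :
    N 1 = 1 ∨ Subsingleton A := by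
  refine or_iff_not_imp_left.2 fun norm_one => subsingleton_of_forall_eq 0 fun x => ?_
  have norm_eq_zero (y : A) : N y = 0 := by
    have norm_mul_one := hN.map_mul y 1
    rw [mul_one] at norm_mul_one
    have : N y * (N 1 - 1) = 0 := by linear_combination -norm_mul_one
    exact (mul_eq_zero.1 this).resolve_right (sub_ne_zero.2 norm_one)
  exact hN.nondegenerate x fun y => by simp only [polar, norm_eq_zero, sub_zero]

theorem conj_conj (hN : IsCompositionNorm N) (x : A) : conj N (conj N x) = x := by
  rcases hN.norm_one_eq_one_or_subsingleton with norm_one | _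
  · have trace_conj : trace N (conj N x) = trace N x := by
      rw [trace, conj, polar_sub_left, polar_smul_left,
        polar_self, norm_one, trace, smul_eq_mul, nsmul_one]
      push_cast
      ring
    rw [conj, trace_conj, conj]
    abel
  · exact Subsingleton.elim _ _

theorem norm_conj (hN : IsCompositionNorm N) (x : A) : N (conj N x) = N x := by
  rcases hN.norm_one_eq_one_or_subsingleton with norm_one | _
  · rw [conj, norm_sub, QuadraticMap.map_smul, polar_smul_left, norm_one,
      polar_comm N 1 x, trace, smul_eq_mul, smul_eq_mul]
    ring
  · rw [Subsingleton.elim (conj N x) x]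

theorem polar_conj_conj (hN : IsCompositionNorm N) (x y : A) :
    polar N (conj N x) (conj N y) = polar N x y := by
  simp only [polar, ← conj_add, hN.norm_conj]

theorem polar_conj_left (hN : IsCompositionNorm N) (x y : A) :
    polar N (conj N x) y = polar N x (conj N y) := by
  rw [← hN.polar_conj_conj, hN.conj_conj]

theorem polar_mul_left [IsScalarTower ℂ A A] (hN : IsCompositionNorm N) (x y z : A) :
    polar N (x * y) z = polar N y (conj N x * z) := by
  have exchange := hN.polar_mul_mul_add x y 1 z
  rw [one_mul, one_mul] at exchange
  rw [conj, sub_mul, smul_mul_assoc, one_mul, polar_sub_right,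
    polar_smul_right, trace, polar_comm N y (x * z), smul_eq_mul]
  linear_combination exchange

theorem polar_mul_right [SMulCommClass ℂ A A] (hN : IsCompositionNorm N) (x y z : A) :
    polar N (x * y) z = polar N x (z * conj N y) := by
  have exchange := hN.polar_mul_mul_add x y z 1
  rw [mul_one, mul_one] at exchange
  rw [conj, mul_sub, mul_smul_comm, mul_one, polar_sub_right,
    polar_smul_right, trace, smul_eq_mul]
  linear_combination exchange

theorem mul_conj_mul [IsScalarTower ℂ A A] (hN : IsCompositionNorm N) (x y : A) :
    x * (conj N x * y) = N x • y :=
  hN.ext fun w => by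
    rw [hN.polar_mul_left, hN.polar_mul_left_mul_left, hN.norm_conj, polar_smul_left,
      smul_eq_mul]

theorem mul_conj_mul_self [SMulCommClass ℂ A A] (hN : IsCompositionNorm N) (x y : A) :
    (y * conj N x) * x = N x • y :=
  hN.ext fun w => by
    rw [hN.polar_mul_right, hN.polar_mul_right_mul_right, hN.norm_conj,
      polar_smul_left, smul_eq_mul, mul_comm]

variable [SMulCommClass ℂ A A] [IsScalarTower ℂ A A]

theorem conj_mul (hN : IsCompositionNorm N) (x y : A) :
    conj N (x * y) = conj N y * conj N x :=
  hN.ext fun w => by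
    rw [hN.polar_conj_left, hN.polar_mul_left, ← hN.polar_mul_right, polar_comm,
      hN.polar_mul_left (conj N y), hN.conj_conj]

theorem polar_conj_mul_rotate (hN : IsCompositionNorm N) (x y z : A) :
    polar N (conj N y) (x * z) = polar N (conj N z) (y * x) := by
  rw [polar_comm, hN.polar_mul_left, ← hN.conj_mul, hN.polar_conj_left]

theorem mul_mul_mul_self (hN : IsCompositionNorm N) (x y z : A) :
    (x * z) * (y * x) = polar N (conj N y) (x * z) • x - N x • (conj N y * conj N z) :=
  hN.ext fun w => by
    have exchange := hN.polar_mul_mul_add x z w (conj N x * conj N y)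
    have cubic_term : polar N z (conj N x * conj N y) = polar N (conj N y) (x * z) := by
      rw [← hN.polar_mul_left, polar_comm]
    have quintic_term : polar N (x * z) (w * (conj N x * conj N y)) =
        polar N ((x * z) * (y * x)) w := by
      rw [hN.polar_mul_right (x * z), hN.conj_mul]
    rw [hN.mul_conj_mul, polar_smul_left, cubic_term, quintic_term] at exchange
    rw [polar_sub_left, polar_smul_left, polar_smul_left,
      hN.polar_mul_right (conj N y), hN.conj_conj]
    simp only [smul_eq_mul] at exchange ⊢
    linear_combination exchange

/-- In the coordinates `x₁`, `x̄₂`, `x₃` the entries of the adjoint of a Hermitian matrix are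
permuted cyclically by a rotation of the indices, so that this identity yields all three
off-diagonal entries of `X^## = det(X) X`. -/
theorem conj_adjoint_mul_adjoint (hN : IsCompositionNorm N) (a b c : ℂ) (x y z : A) :
    conj N ((conj N (y * x) - c • z) * (conj N (x * z) - b • y)) -
        (b * c - N x) • (conj N (z * y) - a • x) =
      (a * b * c - a * N x - b * N y - c * N z + polar N (conj N y) (x * z)) • x := by
  have conj_mul_mul : conj N y * (y * x) = N y • x := by
    have := hN.mul_conj_mul (conj N y) x
    rwa [hN.conj_conj, hN.norm_conj] at this
  have mul_mul_conj : x * z * conj N z = N z • x := by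
    have := hN.mul_conj_mul_self (conj N z) x
    rwa [hN.conj_conj, hN.norm_conj] at this
  rw [hN.conj_mul]
  simp only [conj_sub, conj_smul, hN.conj_conj]
  rw [mul_sub, sub_mul, sub_mul, smul_mul_assoc, smul_mul_assoc, mul_smul_comm, mul_smul_comm,
    hN.mul_mul_mul_self, conj_mul_mul, mul_mul_conj, hN.conj_mul]
  module

end IsCompositionNorm

section Hermitian

variable (N) in
/-- The trace form `(X, Y) ↦ tr(XY)` of `𝒥₃(A)`. -/
def jordanTraceForm : LinearMap.BilinForm ℂ (J3 A) :=
  LinearMap.mk₂ ℂ (fun X Y => ∑ i, X.1 i * Y.1 i + ∑ i, polar N (X.2 i) (Y.2 i))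
    (fun X X' Y => by
      simp only [Prod.fst_add, Prod.snd_add, Pi.add_apply, Fin.sum_univ_three, polar_add_left]
      ring)
    (fun c X Y => by
      simp only [Prod.smul_fst, Prod.smul_snd, Pi.smul_apply, smul_eq_mul, Fin.sum_univ_three,
        polar_smul_left]
      ring)
    (fun X Y Y' => by
      simp only [Prod.fst_add, Prod.snd_add, Pi.add_apply, Fin.sum_univ_three, polar_add_right]
      ring)
    (fun c X Y => by
      simp only [Prod.smul_fst, Prod.smul_snd, Pi.smul_apply, smul_eq_mul, Fin.sum_univ_three,
        polar_smul_right]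
      ring)

theorem jordanTraceForm_apply (X Y : J3 A) :
    jordanTraceForm N X Y = ∑ i, X.1 i * Y.1 i + ∑ i, polar N (X.2 i) (Y.2 i) := rfl

theorem jordanTraceForm_comm (X Y : J3 A) : jordanTraceForm N X Y = jordanTraceForm N Y X := by
  simp only [jordanTraceForm_apply, mul_comm, polar_comm N]

theorem jordanTraceForm_nondegenerate (hN : IsCompositionNorm N) :
    (jordanTraceForm N).Nondegenerate := by
  have separatingLeft : (jordanTraceForm N).SeparatingLeft := fun X h => by
    have fst_eq_zero (i) : X.1 i = 0 := by
      simpa [jordanTraceForm_apply, Pi.single_apply] using h (Pi.single i 1, 0)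
    have snd_eq_zero (i) : X.2 i = 0 := hN.nondegenerate _ fun y => by
      have := h (0, Pi.single i y)
      fin_cases i <;> simpa [jordanTraceForm_apply, Fin.sum_univ_three] using this
    exact Prod.ext (funext fst_eq_zero) (funext snd_eq_zero)
  exact ⟨separatingLeft, fun Y h => separatingLeft Y fun X => by
    rw [jordanTraceForm_comm, h]⟩

variable [SMulCommClass ℂ A A] [IsScalarTower ℂ A A]

variable (N) in
/-- The adjoint `X ↦ X^#` of `𝒥₃(A)`, the quadratic map with `X X^# = det(X) 1`. -/
def sharp (X : J3 A) : J3 A :=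
  (![X.1 1 * X.1 2 - N (X.2 0), X.1 0 * X.1 2 - N (X.2 1), X.1 0 * X.1 1 - N (X.2 2)],
   ![X.2 1 * conj N (X.2 2) - X.1 0 • X.2 0, X.2 0 * X.2 2 - X.1 1 • X.2 1,
     conj N (X.2 0) * X.2 1 - X.1 2 • X.2 2])

theorem det_eq (hN : IsCompositionNorm N) (X : J3 A) : det N X =
    X.1 0 * X.1 1 * X.1 2 - X.1 0 * N (X.2 0) - X.1 1 * N (X.2 1) - X.1 2 * N (X.2 2) +
      polar N (X.2 1) (X.2 0 * X.2 2) := by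
  rw [det, trace, hN.polar_mul_left, hN.conj_mul, hN.conj_conj, hN.conj_conj, mul_one]

theorem sharp_sharp_fst (hN : IsCompositionNorm N) (X : J3 A) :
    (sharp N (sharp N X)).1 = det N X • X.1 := by
  obtain ⟨r, v⟩ := X
  have cubic_zero : polar N (v 1 * conj N (v 2)) (v 0) = polar N (v 1) (v 0 * v 2) := by
    rw [hN.polar_mul_right, hN.conj_conj]
  have cubic_one : polar N (v 0 * v 2) (v 1) = polar N (v 1) (v 0 * v 2) :=
    polar_comm ..
  have cubic_two : polar N (conj N (v 0) * v 1) (v 2) = polar N (v 1) (v 0 * v 2) := by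
    rw [hN.polar_mul_left, hN.conj_conj]
  funext i
  fin_cases i <;>
  · simp only [sharp, det_eq hN, norm_sub, QuadraticMap.map_smul, hN.map_mul, hN.norm_conj,
      polar_smul_right, cubic_zero, cubic_one, cubic_two, Matrix.cons_val, Pi.smul_apply,
      smul_eq_mul, Fin.zero_eta, Fin.mk_one, Fin.reduceFinMk]
    ring

theorem sharp_sharp_snd (hN : IsCompositionNorm N) (X : J3 A) :
    (sharp N (sharp N X)).2 = det N X • X.2 := by
  obtain ⟨r, v⟩ := X
  have entry_zero := hN.conj_adjoint_mul_adjoint (r 0) (r 1) (r 2) (v 0) (conj N (v 1)) (v 2)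
  have entry_one := congrArg (conj N) <|
    hN.conj_adjoint_mul_adjoint (r 1) (r 2) (r 0) (conj N (v 1)) (v 2) (v 0)
  have entry_two := hN.conj_adjoint_mul_adjoint (r 2) (r 0) (r 1) (v 2) (v 0) (conj N (v 1))
  rw [hN.polar_conj_mul_rotate, hN.polar_conj_mul_rotate] at entry_one
  rw [hN.polar_conj_mul_rotate] at entry_two
  simp only [conj_sub, conj_smul, hN.conj_mul, hN.conj_conj, hN.norm_conj]
    at entry_zero entry_one entry_two
  funext i
  fin_cases i
  all_goals simp only [sharp, det_eq hN, conj_sub, conj_smul, hN.conj_mul, hN.conj_conj,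
    Pi.smul_apply, Fin.zero_eta, Fin.mk_one, Fin.reduceFinMk, Matrix.cons_val]
  · exact entry_zero
  · linear_combination (norm := module) entry_one
  · linear_combination (norm := module) entry_two

variable (N) in
/-- A trilinear form whose symmetrization is the polarization of the determinant. -/
def detTrilinear : Trilinear (J3 A) :=
  LinearMap.mk₂ ℂ (fun X Y =>
      (X.1 0 * Y.1 1) • LinearMap.proj 2 ∘ₗ LinearMap.fst ℂ (Fin 3 → ℂ) (Fin 3 → A) +
      (QuadraticMap.polarBilin N (X.2 1) ∘ₗ LinearMap.mulLeft ℂ (Y.2 0) ∘ₗ LinearMap.proj 2 -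
        ∑ i, (1 / 2 * X.1 i) • QuadraticMap.polarBilin N (Y.2 i) ∘ₗ LinearMap.proj i) ∘ₗ
          LinearMap.snd ℂ (Fin 3 → ℂ) (Fin 3 → A))
    (fun X X' Y => LinearMap.ext fun Z => by simp [Fin.sum_univ_three]; ring)
    (fun c X Y => LinearMap.ext fun Z => by simp [Fin.sum_univ_three]; ring)
    (fun X Y Y' => LinearMap.ext fun Z => by simp [Fin.sum_univ_three, add_mul]; ring)
    (fun c X Y => LinearMap.ext fun Z => by simp [Fin.sum_univ_three, smul_mul_assoc]; ring)

theorem detTrilinear_apply (X Y Z : J3 A) : detTrilinear N X Y Z =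
    X.1 0 * Y.1 1 * Z.1 2 + polar N (X.2 1) (Y.2 0 * Z.2 2) -
      ∑ i, 1 / 2 * X.1 i * polar N (Y.2 i) (Z.2 i) := by
  simp only [detTrilinear, LinearMap.mk₂_apply, Fin.sum_univ_three, LinearMap.add_apply,
    LinearMap.sub_apply, LinearMap.smul_apply, LinearMap.comp_apply, LinearMap.fst_apply,
    LinearMap.snd_apply, LinearMap.proj_apply, LinearMap.mulLeft_apply,
    QuadraticMap.polarBilin_apply_apply, smul_eq_mul]
  ring

variable (N) in
/-- The polarization of the determinant of `𝒥₃(A)`. -/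
def detCubic : Trilinear (J3 A) :=
  symmetrize (detTrilinear N)

theorem isSymm_detCubic : IsSymm (detCubic N) :=
  isSymm_symmetrize _

theorem detCubic_apply_self (hN : IsCompositionNorm N) (X : J3 A) :
    detCubic N X X X = det N X := by
  simp only [detCubic, symmetrize_apply, detTrilinear_apply, det_eq hN, Fin.sum_univ_three,
    polar_self, nsmul_eq_mul, Nat.cast_ofNat]
  ring

theorem detCubic_apply_apply (hN : IsCompositionNorm N) (X Y : J3 A) :
    detCubic N X X Y = 1 / 3 * jordanTraceForm N (sharp N X) Y := by
  have entry_zero : polar N (X.2 1) (Y.2 0 * X.2 2) =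
      polar N (X.2 1 * conj N (X.2 2)) (Y.2 0) := by
    rw [hN.polar_mul_right, hN.conj_conj]
  have entry_two : polar N (X.2 1) (X.2 0 * Y.2 2) =
      polar N (conj N (X.2 0) * X.2 1) (Y.2 2) := by
    rw [hN.polar_mul_left, hN.conj_conj]
  simp only [detCubic, symmetrize_apply, detTrilinear_apply, jordanTraceForm_apply, sharp,
    Fin.sum_univ_three, polar_self, entry_zero, entry_two,
    polar_comm N (Y.2 _) (X.2 _), polar_comm N (Y.2 1) (X.2 0 * X.2 2),
    Matrix.cons_val, polar_sub_left, polar_smul_left, smul_eq_mul,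
    nsmul_eq_mul, Nat.cast_ofNat]
  ring

theorem detCubic_ne_zero (hN : IsCompositionNorm N) : detCubic N ≠ 0 := fun h => by
  have det_one := detCubic_apply_self hN (![1, 1, 1], 0)
  simp [h, det_eq hN] at det_one

theorem isCubicAdjoint_detCubic (hN : IsCompositionNorm N) :
    IsCubicAdjoint (detCubic N) (jordanTraceForm N) (sharp N) where
  trace_comm := jordanTraceForm_comm
  nondegenerate := jordanTraceForm_nondegenerate hN
  apply_apply := detCubic_apply_apply hN
  sharp_sharp X := by
    rw [detCubic_apply_self hN]
    exact Prod.ext (sharp_sharp_fst hN X) (sharp_sharp_snd hN X)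

end Hermitian

end Composition

/-! ### Binary cubics -/

section BinaryCubic

/-- The cubic `x ↦ x³` on `ℂ`. -/
def binaryCubic : Trilinear ℂ :=
  (LinearMap.mul ℂ ℂ).compr₂ (LinearMap.mul ℂ ℂ)

theorem binaryCubic_apply (x y z : ℂ) : binaryCubic x y z = x * y * z := rfl

theorem isSymm_binaryCubic : IsSymm binaryCubic :=
  ⟨fun x y z => by simp only [binaryCubic_apply]; ring,
    fun x y z => by simp only [binaryCubic_apply]; ring⟩

theorem binaryCubic_ne_zero : binaryCubic ≠ 0 := fun h => by
  simpa [h] using binaryCubic_apply 1 1 1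

theorem stabilizer_binaryCubic : stabilizer binaryCubic = ⊥ := by
  refine (LieSubalgebra.eq_bot_iff _).2 fun D hD => LinearMap.ext_ring ?_
  have annihilation := Annihilates.apply_diag hD isSymm_binaryCubic 1
  rwa [binaryCubic_apply, mul_one, mul_one] at annihilation

theorem isCubicAdjoint_binaryCubic :
    IsCubicAdjoint binaryCubic ((3 : ℂ) • LinearMap.mul ℂ ℂ) (fun x => x ^ 2) where
  trace_comm x y := by simp [mul_comm]
  nondegenerate := by
    constructor
    · intro x hx
      simpa using hx 1
    · intro x hx
      simpa using hx 1
  apply_apply x y := by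
    simp only [binaryCubic_apply, LinearMap.smul_apply, LinearMap.mul_apply', smul_eq_mul]
    ring
  sharp_sharp x := by
    simp only [binaryCubic_apply, smul_eq_mul]
    ring

theorem dual_apply_eq_mul (s : Module.Dual ℂ ℂ) (x : ℂ) : s x = x * s 1 := by
  rw [← smul_eq_mul, ← map_smul, smul_eq_mul, mul_one]

theorem dualCubic_binaryCubic_apply (s t u : Module.Dual ℂ ℂ) :
    isCubicAdjoint_binaryCubic.dualCubic s t u = 2 * (s 1 * t 1 * u 1) := by
  have symm_apply (s : Module.Dual ℂ ℂ) : (LinearMap.BilinForm.toDual _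
      isCubicAdjoint_binaryCubic.nondegenerate).symm s = 1 / 3 * s 1 := by
    have := LinearMap.BilinForm.apply_toDual_symm_apply
      (hB := isCubicAdjoint_binaryCubic.nondegenerate) s 1
    simp only [LinearMap.smul_apply, LinearMap.mul_apply', smul_eq_mul] at this
    linear_combination (1 / 3 : ℂ) * this
  rw [IsCubicAdjoint.dualCubic_apply, symm_apply, symm_apply, symm_apply, binaryCubic_apply]
  ring

theorem contract_dualCubic_binaryCubic (s t : Module.Dual ℂ ℂ) :
    contract isCubicAdjoint_binaryCubic.dualCubic s t = 2 * (s 1 * t 1) := by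
  have := apply_contract isCubicAdjoint_binaryCubic.dualCubic s t LinearMap.id
  rwa [dualCubic_binaryCubic_apply, LinearMap.id_apply, LinearMap.id_apply, mul_one] at this

theorem exists_Q_binaryCubic_eq_discr : ∃ a b : ℂ, a ≠ 0 ∧ b ≠ 0 ∧
    ∀ (α r β : ℂ) (s : Module.Dual ℂ ℂ),
      Q binaryCubic isCubicAdjoint_binaryCubic.dualCubic (α, r, s, β) =
        -(1 / 3) * Cubic.discr ⟨α, a * r, b * s 1, β⟩ := by
  obtain ⟨a, ha⟩ := IsAlgClosed.exists_pow_nat_eq (1 / 4 : ℂ) (n := 3) (by norm_num)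
  have ha0 : a ≠ 0 := by
    rintro rfl
    norm_num at ha
  obtain ⟨b, hab⟩ : ∃ b, a * b = 1 / 2 := ⟨1 / (2 * a), by field_simp⟩
  have hb : 4 * b ^ 3 = 2 := by
    linear_combination -16 * b ^ 3 * ha +
      16 * (a ^ 2 * b ^ 2 + 1 / 2 * a * b + 1 / 4) * hab
  refine ⟨a, b, ha0, right_ne_zero_of_mul (a := a) (by norm_num [hab]), fun α r β s => ?_⟩
  simp only [Q, Cubic.discr, binaryCubic_apply, dualCubic_binaryCubic_apply,
    contract_dualCubic_binaryCubic, dual_apply_eq_mul s r]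
  linear_combination (r ^ 2 * s 1 ^ 2 / 3 * (a * b + 1 / 2) + 6 * α * r * s 1 * β) * hab -
    α * s 1 ^ 3 / 3 * hb - 4 / 3 * r ^ 3 * β * ha

end BinaryCubic

end Freudenthal

end

theorem mainTheorem1 :
    -- the general construction
    (∀ (W : Type u) [AddCommGroup W] [Module ℂ W] [FiniteDimensional ℂ W]
      (𝔥 : LieSubalgebra ℂ (Module.End ℂ W)) (C : Freudenthal.Trilinear W),
      LieAlgebra.IsSemisimple ℂ 𝔥 →
      LieModule.IsIrreducible ℂ 𝔥 W →
      Freudenthal.SymSquareSplits 𝔥 →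
      Freudenthal.IsSymm C → C ≠ 0 → Freudenthal.IsInvariant 𝔥 C →
      (∃ Cd : Freudenthal.Trilinear (Module.Dual ℂ W),
        Freudenthal.IsSymm Cd ∧ Cd ≠ 0 ∧ Freudenthal.IsDualInvariant 𝔥 Cd) ∧
      ∀ Cd : Freudenthal.Trilinear (Module.Dual ℂ W),
        Freudenthal.IsSymm Cd → Cd ≠ 0 → Freudenthal.IsDualInvariant 𝔥 Cd →
        ∃ c : ℂ, c ≠ 0 ∧
          Freudenthal.QIsInvariant 𝔥 C (c • Cd) ∧
          ((Freudenthal.IsIrreducibleOrZero (Freudenthal.altSquare 𝔥) ∨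
              𝔥 = Freudenthal.stabilizer C) →
            Freudenthal.IsLieAction 𝔥 C (c • Cd)) ∧
          ∀ c' : ℂ, (Freudenthal.QIsInvariant 𝔥 C (c' • Cd) ∨
            Freudenthal.IsLieAction 𝔥 C (c' • Cd)) → c' = c) ∧
    -- Hermitian matrices of order three over a composition algebra
    (∀ (A : Type v) [NonAssocRing A] [Module ℂ A] [SMulCommClass ℂ A A] [IsScalarTower ℂ A A]
      [FiniteDimensional ℂ A] (N : QuadraticForm ℂ A), Freudenthal.IsCompositionNorm N →
      ∃ (C : Freudenthal.Trilinear (Freudenthal.J3 A))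
        (Cd : Freudenthal.Trilinear (Module.Dual ℂ (Freudenthal.J3 A))),
        Freudenthal.IsSymm C ∧ (∀ X, C X X X = Freudenthal.det N X) ∧
        Freudenthal.IsSymm Cd ∧ Cd ≠ 0 ∧
        Freudenthal.IsDualInvariant (Freudenthal.stabilizer C) Cd ∧
        Freudenthal.IsLieAction (Freudenthal.stabilizer C) C Cd ∧
        Freudenthal.QIsInvariant (Freudenthal.stabilizer C) C Cd) ∧
    -- the discriminant of a binary cubic
    (∃ (C : Freudenthal.Trilinear ℂ) (Cd : Freudenthal.Trilinear (Module.Dual ℂ ℂ)),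
      Freudenthal.IsSymm C ∧ (∀ x, C x x x = x ^ 3) ∧ Freudenthal.IsSymm Cd ∧ Cd ≠ 0 ∧
      Freudenthal.IsLieAction ⊥ C Cd ∧ Freudenthal.QIsInvariant ⊥ C Cd ∧
      ∃ a b : ℂ, a ≠ 0 ∧ b ≠ 0 ∧ ∀ (α r β : ℂ) (s : Module.Dual ℂ ℂ),
        Freudenthal.Q C Cd (α, r, s, β) = -(1 / 3) * Cubic.discr ⟨α, a * r, b * s 1, β⟩) := by
  refine ⟨fun W _ _ _ 𝔥 C semisimple irreducible splits hC hC0 hi => ?_,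
    fun A _ _ _ _ _ N hN => ?_, ?_⟩
  · exact Freudenthal.exists_invariant_quartic splits hC hC0 hi
  · have hC := Freudenthal.isSymm_detCubic (N := N)
    have adjoint := Freudenthal.isCubicAdjoint_detCubic hN
    exact ⟨Freudenthal.detCubic N, adjoint.dualCubic, hC, Freudenthal.detCubic_apply_self hN,
      adjoint.isSymm_dualCubic hC, adjoint.dualCubic_ne_zero (Freudenthal.detCubic_ne_zero hN),
      adjoint.isDualInvariant hC, adjoint.isLieAction hC, adjoint.qIsInvariant hC⟩
  · have hC := Freudenthal.isSymm_binaryCubic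
    have adjoint := Freudenthal.isCubicAdjoint_binaryCubic
    exact ⟨Freudenthal.binaryCubic, adjoint.dualCubic, hC,
      fun x => by rw [Freudenthal.binaryCubic_apply]; ring, adjoint.isSymm_dualCubic hC,
      adjoint.dualCubic_ne_zero Freudenthal.binaryCubic_ne_zero,
      Freudenthal.stabilizer_binaryCubic ▸ adjoint.isLieAction hC,
      Freudenthal.stabilizer_binaryCubic ▸ adjoint.qIsInvariant hC,
      Freudenthal.exists_Q_binaryCubic_eq_discr⟩
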